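/- Fix an infinite set $\mathcal A$ of visible actions and an invisible action $\tau\notin\mathcal A$. A \emph{labelled transition system} (LTS) $L=(S,\Sigma,\Delta,\hat s)$ consists of a set $S$ of states, an alphabet $\Sigma=\Sigma(L)\subseteq\mathcal A$, transitions $\Delta\subseteq S\times(\Sigma\cup\{\tau\})\times S$ and an initial state $\hat s\in S$; all these sets may be infinite. The operators are action prefix $a.L$ (a new initial state with an $a$-transition to $\hat s$; the alphabet is $\Sigma\cup\{a\}$), hiding $L\setminus A$ (actions in $A$ become $\tau$ and leave the alphabet), relational renaming $L\Phi$ for $\Phi\subseteq\mathcal A\times\mathcal A$ (each visible label $a$, also in the alphabet, is replaced by all $b$ with $(a,b)\in\Phi$, and is kept if there is no such $b$), and parallel composition $L_1\parallel L_2$ (alphabet $\Sigma_1\cup\Sigma_2$; the components synchronize exactly on the actions in $\Sigma_1\cap\Sigma_2$). A \emph{congruence} is an equivalence relation $\cong$ on LTSs such that $L\cong L'$ implies $a.L\cong a.L'$, $L\setminus A\cong L'\setminus A$, $L\Phi\cong L'\Phi$, $L\parallel L''\cong L'\parallel L''$ and $L''\parallel L\cong L''\parallel L'$ for all $a$, $A$,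 $\Phi$ and $L''$. For $\sigma\in\Sigma^*$, write $\hat s\Rightarrow^\sigma s$ if a finite path from $\hat s$ to $s$ has $\sigma$ as its sequence of non-$\tau$ labels. Let \begin{itemize} \item $\mathit{Tr}(L)$ be the set of $\sigma\in\Sigma^*$ such that $\hat s\Rightarrow^\sigma s$ for some $s$; \item $\mathit{Div}(L)$ be the set of $\sigma\in\Sigma^*$ such that $\hat s\Rightarrow^\sigma s$ for some $s$ from which an infinite path of $\tau$-transitions starts; \item $\mathit{Inf}(L)$ be the set of $\xi\in\Sigma^\omega$ that are the sequence of non-$\tau$ labels of an infinite path from $\hat s$; \item $\mathit{Sf}(L)$ be the set of $(\sigma,A)\in\Sigma^*\times 2^\Sigma$ such that $\hat s\Rightarrow^\sigma s$ for some $s$ that has no outgoing transition with a label in $A\cup\{\tau\}$; \item $\mathit{minD}(L)$ be the set of $\sigma\in\mathit{Div}(L)$ none of whose proper prefixes is in $\mathit{Div}(L)$; \item $\mathit{anI}(L)$ be the set of $\xi\in\mathit{Inf}(L)$ none of whose finite prefixes (including the empty one) is in $\mathit{minD}(L)$. \end{itemize} LTSs $L$ and $L'$ are \emph{CFFD-equivalent}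 if $\Sigma(L)=\Sigma(L')$, $\mathit{Sf}(L)=\mathit{Sf}(L')$, $\mathit{Div}(L)=\mathit{Div}(L')$ and $\mathit{Inf}(L)=\mathit{Inf}(L')$. A relation $\cong$ \emph{preserves} $X$ if $L\cong L'$ implies $X(L)=X(L')$. \textbf{Theorem.} Let $\cong$ be a congruence such that CFFD-equivalent LTSs are always related by $\cong$. Suppose that $\cong$ preserves $\mathit{Tr}$, $\mathit{Sf}$ and $\mathit{minD}$, but preserves neither $\mathit{Div}$ nor $\mathit{Inf}$. Then $\cong$ is the equivalence induced by $\Sigma$, $\mathit{Tr}$, $\mathit{Sf}$, $\mathit{minD}$ and $\mathit{anI}$: for all LTSs $L$ and $L'$, we have $L\cong L'$ if and only if $\Sigma(L)=\Sigma(L')$, $\mathit{Tr}(L)=\mathit{Tr}(L')$, $\mathit{Sf}(L)=\mathit{Sf}(L')$, $\mathit{minD}(L)=\mathit{minD}(L')$ and $\mathit{anI}(L)=\mathit{anI}(L')$. -/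

import Mathlib

universe u v

/-- A labelled transition system with visible actions taken from `Act`. A transition label is
`some a` for a visible action `a` and `none` for the invisible action `τ`; so `τ` is never in the
alphabet, and every visible label of a transition is in the alphabet. -/
structure LTS (Act : Type u) : Type (max u (v + 1)) where
  State : Type v
  alphabet : Set Act
  trans : State → Option Act → State → Prop
  init : State
  trans_mem : ∀ {s : State} {a : Act} {s' : State}, trans s (some a) s' → a ∈ alphabet

namespace LTS

variable {Act : Type u}

/-! ### The four operators -/

/-- Action prefixing `a.L`: a fresh initial state `none` with one `a`-transition to the initial
state of `L`. -/
def act (a : Act) (L : LTS.{u, v} Act) : LTS.{u, v} Act where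
  State := Option L.State
  alphabet := L.alphabet ∪ {a}
  trans s l s' :=
    (∃ t t', s = some t ∧ s' = some t' ∧ L.trans t l t') ∨
      (s = none ∧ l = some a ∧ s' = some L.init)
  init := none
  trans_mem := by
    rintro s b s' (⟨t, t', -, -, h⟩ | ⟨-, h, -⟩)
    · exact Or.inl (L.trans_mem h)
    · exact Or.inr (Option.some.inj h)

/-- Hiding `L \ A`: the actions in `A` become `τ`. -/
def hide (L : LTS.{u, v} Act) (A : Set Act) : LTS.{u, v} Act where
  State := L.State
  alphabet := L.alphabet \ A
  trans s l s' := ∃ k, L.trans s k s' ∧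
    ((l = k ∧ ∀ b ∈ A, k ≠ some b) ∨ (l = none ∧ ∃ b ∈ A, k = some b))
  init := L.init
  trans_mem := by
    rintro s a s' ⟨k, hk, ⟨rfl, h⟩ | ⟨h, -⟩⟩
    · exact ⟨L.trans_mem hk, fun ha => h a ha rfl⟩
    · cases h

/-- `Φ(a, b)`: either `(a, b) ∈ Φ`, or `a = b` and `a` is not in the domain of `Φ`. -/
def Renames (Φ : Set (Act × Act)) (a b : Act) : Prop :=
  (a, b) ∈ Φ ∨ (a = b ∧ ∀ c, (a, c) ∉ Φ)

/-- The extension of `Renames` to labels: `τ` is renamed to `τ` only. -/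
def RenamesLabel (Φ : Set (Act × Act)) (k l : Option Act) : Prop :=
  (k = none ∧ l = none) ∨ ∃ a b, k = some a ∧ l = some b ∧ Renames Φ a b

/-- Relational renaming `L Φ`. -/
def rename (L : LTS.{u, v} Act) (Φ : Set (Act × Act)) : LTS.{u, v} Act where
  State := L.State
  alphabet := {b | ∃ a ∈ L.alphabet, Renames Φ a b}
  trans s l s' := ∃ k, L.trans s k s' ∧ RenamesLabel Φ k l
  init := L.init
  trans_mem := by
    rintro s c s' ⟨k, hk, ⟨-, h⟩ | ⟨a, b, rfl, h, hΦ⟩⟩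
    · cases h
    · cases h
      exact ⟨a, L.trans_mem hk, hΦ⟩

/-- Parallel composition `L₁ || L₂`. -/
def par (L₁ L₂ : LTS.{u, v} Act) : LTS.{u, v} Act where
  State := L₁.State × L₂.State
  alphabet := L₁.alphabet ∪ L₂.alphabet
  trans s l s' :=
    ((∀ a ∈ L₂.alphabet, l ≠ some a) ∧ L₁.trans s.1 l s'.1 ∧ s'.2 = s.2) ∨
    ((∀ a ∈ L₁.alphabet, l ≠ some a) ∧ L₂.trans s.2 l s'.2 ∧ s'.1 = s.1) ∨
    ((∃ a ∈ L₁.alphabet ∩ L₂.alphabet, l = some a) ∧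
      L₁.trans s.1 l s'.1 ∧ L₂.trans s.2 l s'.2)
  init := (L₁.init, L₂.init)
  trans_mem := by
    rintro s a s' (⟨-, h, -⟩ | ⟨-, h, -⟩ | ⟨-, h, -⟩)
    · exact Or.inl (L₁.trans_mem h)
    · exact Or.inr (L₂.trans_mem h)
    · exact Or.inl (L₁.trans_mem h)

/-! ### Executions -/

/-- `s ⇒ s'` by finitely many (possibly zero) `τ`-transitions. -/
def TauReach (L : LTS.{u, v} Act) : L.State → L.State → Prop :=
  Relation.ReflTransGen fun s s' => L.trans s none s'

/-- `s ⇒ s'` with visible actions `σ`. -/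
def Reach (L : LTS.{u, v} Act) : L.State → List Act → L.State → Prop
  | s, [], s' => L.TauReach s s'
  | s, a :: σ, s' => ∃ t t', L.TauReach s t ∧ L.trans t (some a) t' ∧ Reach L t' σ s'

/-- There is an infinite path from `s` whose sequence of visible actions is `ξ`. -/
def InfReach (L : LTS.{u, v} Act) (s : L.State) (ξ : ℕ → Act) : Prop :=
  ∃ p q : ℕ → L.State, p 0 = s ∧
    ∀ i, L.TauReach (p i) (q i) ∧ L.trans (q i) (some (ξ i)) (p (i + 1))

/-- There is an infinite path of `τ`-transitions from `s`. -/
def Diverges (L : LTS.{u, v} Act) (s : L.State) : Prop :=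
  ∃ p : ℕ → L.State, p 0 = s ∧ ∀ i, L.trans (p i) none (p (i + 1))

theorem Reach.mem_alphabet {L : LTS.{u, v} Act} {σ : List Act} :
    ∀ {s s' : L.State}, L.Reach s σ s' → ∀ a ∈ σ, a ∈ L.alphabet := by
  induction σ with
  | nil => intro s s' _ a ha; simp at ha
  | cons b σ ih =>
    rintro s s' ⟨t, t', -, hb, h⟩ a ha
    rcases List.mem_cons.1 ha with rfl | ha
    · exact L.trans_mem hb
    · exact ih h a ha

/-! ### Semantic sets

Sequences executed by an LTS only contain actions of its alphabet (`Reach.mem_alphabet`,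
`trans_mem`), so this needs not be demanded in the first four definitions. -/

/-- Traces. -/
def Tr (L : LTS.{u, v} Act) : Set (List Act) :=
  {σ | ∃ s, L.Reach L.init σ s}

/-- Divergence traces. -/
def Div (L : LTS.{u, v} Act) : Set (List Act) :=
  {σ | ∃ s, L.Reach L.init σ s ∧ L.Diverges s}

/-- Infinite traces. -/
def Inf (L : LTS.{u, v} Act) : Set (ℕ → Act) :=
  {ξ | L.InfReach L.init ξ}

/-- Stable failures. -/
def Sf (L : LTS.{u, v} Act) : Set (List Act × Set Act) :=
  {x | x.2 ⊆ L.alphabet ∧ ∃ s, L.Reach L.init x.1 s ∧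
    (∀ s', ¬ L.trans s none s') ∧ ∀ a ∈ x.2, ∀ s', ¬ L.trans s (some a) s'}

/-- Minimal divergence traces. -/
def minD (L : LTS.{u, v} Act) : Set (List Act) :=
  {σ | σ ∈ L.Div ∧ ∀ i < σ.length, σ.take i ∉ L.Div}

/-- Infinite extensions of minimal divergence traces. -/
def extI (L : LTS.{u, v} Act) : Set (ℕ → Act) :=
  {ξ | (∀ j, ξ j ∈ L.alphabet) ∧ ∃ i, (List.range i).map ξ ∈ L.minD}

/-- Always-nondivergent infinite traces. -/
def anI (L : LTS.{u, v} Act) : Set (ℕ → Act) :=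
  L.Inf \ L.extI

/-! ### Equivalences and congruences -/

/-- CFFD-equivalence: equal alphabets, stable failures, divergence traces and infinite traces. -/
def CFFD (L L' : LTS.{u, v} Act) : Prop :=
  L.alphabet = L'.alphabet ∧ L.Sf = L'.Sf ∧ L.Div = L'.Div ∧ L.Inf = L'.Inf

/-- `r` is an equivalence that is compatible with the four operators. -/
structure IsCongruence (r : LTS.{u, v} Act → LTS.{u, v} Act → Prop) : Prop where
  equivalence : Equivalence r
  act : ∀ (a : Act) {L L' : LTS.{u, v} Act}, r L L' → r (L.act a) (L'.act a)
  hide : ∀ (A : Set Act) {L L' : LTS.{u, v} Act}, r L L' → r (L.hide A) (L'.hide A)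
  rename : ∀ (Φ : Set (Act × Act)) {L L' : LTS.{u, v} Act},
    r L L' → r (L.rename Φ) (L'.rename Φ)
  par_right : ∀ (M : LTS.{u, v} Act) {L L' : LTS.{u, v} Act}, r L L' → r (L.par M) (L'.par M)
  par_left : ∀ (M : LTS.{u, v} Act) {L L' : LTS.{u, v} Act}, r L L' → r (M.par L) (M.par L')

/-- `r` preserves `X`: related LTSs have the same `X`. -/
def Preserves (r : LTS.{u, v} Act → LTS.{u, v} Act → Prop) {β : Type*}
    (X : LTS.{u, v} Act → β) : Prop :=
  ∀ ⦃L L' : LTS.{u, v} Act⦄, r L L' → X L = X L'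

end LTS

/-! Only if: synchronizing with a one-action loop makes alphabets visible in traces
(`alphabet_subset`). For `anI`, consider a context that lets `L` perform a fixed `ξ` invisibly. The
empty trace then diverges iff `ξ` is an infinite trace of `L` or some finite prefix of `ξ` is a
divergence trace. Since `minD` detects divergence of the empty trace, `anI` is preserved
(`anI_subset`).

If: it suffices that every `L` is related to some `M` whose `Div` and `Inf` are as large as traces
and minimal divergence traces permit (`exists_saturated`). These sets are functions of `Tr`, `minD`
and `anI` (`extD_eq`, `Inf_union_eq`), so the saturated versions of `L` and `L'` are
CFFD-equivalent.

To saturate, take related `B`, `B'` that differ in a divergence trace, respectively an infinite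
trace. A context built from `L` behaves like `L`, but after a divergence trace of `L` it may start
driving its argument. Filled with `B'` it is CFFD-equivalent to `L`; filled with `B` it has all the
desired divergence or infinite traces; by congruence the two fillings are related.

The contexts are products with a controller. They are compositions of the four operators because an
infinite set of actions can code pairs of labels (`controlContext_eq`). -/

namespace LTS

variable {Act : Type u}

/-! ### Executions -/

section Executions

variable {L M : LTS.{u, v} Act}

theorem Reach.tau_left {s t u : L.State} {σ : List Act} (h : L.TauReach s t)
    (h' : L.Reach t σ u) : L.Reach s σ u := by
  cases σ with
  | nil => exact Relation.ReflTransGen.trans h h'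
  | cons a σ =>
    obtain ⟨x, y, h1, h2, h3⟩ := h'
    exact ⟨x, y, Relation.ReflTransGen.trans h h1, h2, h3⟩

theorem reach_append {s u : L.State} {σ ρ : List Act} :
    L.Reach s (σ ++ ρ) u ↔ ∃ t, L.Reach s σ t ∧ L.Reach t ρ u := by
  induction σ generalizing s with
  | nil =>
    exact ⟨fun h => ⟨s, Relation.ReflTransGen.refl, h⟩, fun ⟨t, h, h'⟩ => h'.tau_left h⟩
  | cons a σ ih =>
    constructor
    · rintro ⟨x, y, h1, h2, h3⟩
      obtain ⟨t, h4, h5⟩ := ih.1 h3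
      exact ⟨t, ⟨x, y, h1, h2, h4⟩, h5⟩
    · rintro ⟨t, ⟨x, y, h1, h2, h4⟩, h5⟩
      exact ⟨x, y, h1, h2, ih.2 ⟨t, h4, h5⟩⟩

theorem Reach.refl (s : L.State) : L.Reach s [] s := Relation.ReflTransGen.refl

theorem Reach.append {s t u : L.State} {σ ρ : List Act} (h : L.Reach s σ t)
    (h' : L.Reach t ρ u) : L.Reach s (σ ++ ρ) u :=
  reach_append.2 ⟨t, h, h'⟩

theorem Reach.of_tau {s t : L.State} (h : L.trans s none t) : L.Reach s [] t :=
  Relation.ReflTransGen.single h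

theorem Reach.of_trans {s t : L.State} {a : Act} (h : L.trans s (some a) t) :
    L.Reach s [a] t :=
  ⟨s, t, Relation.ReflTransGen.refl, h, Relation.ReflTransGen.refl⟩

theorem Reach.tau_right {s t u : L.State} {σ : List Act} (h : L.Reach s σ t)
    (h' : L.trans t none u) : L.Reach s σ u := by
  simpa using h.append (Reach.of_tau h')

theorem Reach.tauReach_right {s t u : L.State} {σ : List Act} (h : L.Reach s σ t)
    (h' : L.TauReach t u) : L.Reach s σ u := by
  simpa using h.append (show L.Reach t [] u from h')

theorem Reach.trans_right {s t u : L.State} {σ : List Act} {a : Act} (h : L.Reach s σ t)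
    (h' : L.trans t (some a) u) : L.Reach s (σ ++ [a]) u :=
  h.append (Reach.of_trans h')

/-- Induction along an execution, adding transitions at its end. -/
theorem Reach.rec_right {motive : List Act → L.State → Prop}
    (tau : ∀ σ s s', motive σ s → L.trans s none s' → motive σ s')
    (vis : ∀ σ s a s', motive σ s → L.trans s (some a) s' → motive (σ ++ [a]) s') :
    ∀ {σ : List Act} {σ₀ : List Act} {s s' : L.State}, motive σ₀ s → L.Reach s σ s' →
      motive (σ₀ ++ σ) s' := by
  have key : ∀ {σ₀ : List Act} {s s' : L.State}, motive σ₀ s → L.TauReach s s' →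
      motive σ₀ s' := by
    intro σ₀ s s' h0 h
    induction h with
    | refl => exact h0
    | tail _ h ih => exact tau _ _ _ ih h
  intro σ
  induction σ with
  | nil =>
    intro σ₀ s s' h0 h
    simpa using key h0 h
  | cons a σ ih =>
    rintro σ₀ s s' h0 ⟨x, y, h1, h2, h3⟩
    simpa using ih (vis _ _ _ _ (key h0 h1) h2) h3

/-- A weak simulation given by a function on a set of states that is closed under predecessors
maps executions to executions. -/
theorem Reach.map (f : L.State → M.State) (good : L.State → Prop)
    (back : ∀ x l y, L.trans x l y → good y → good x)
    (tau : ∀ x y, L.trans x none y → good y → M.TauReach (f x) (f y))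
    (vis : ∀ x a y, L.trans x (some a) y → good y → M.Reach (f x) [a] (f y)) :
    ∀ {σ : List Act} {x y : L.State}, L.Reach x σ y → good y →
      M.Reach (f x) σ (f y) ∧ good x := by
  have key : ∀ {x y : L.State}, L.TauReach x y → good y → M.TauReach (f x) (f y) ∧ good x := by
    intro x y h hy
    induction h using Relation.ReflTransGen.head_induction_on with
    | refl => exact ⟨Relation.ReflTransGen.refl, hy⟩
    | head h1 _ ih =>
      exact ⟨Relation.ReflTransGen.trans (tau _ _ h1 ih.2) ih.1, back _ _ _ h1 ih.2⟩
  intro σ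
  induction σ with
  | nil => exact fun h hy => key h hy
  | cons a σ ih =>
    rintro x y ⟨z, w, h1, h2, h3⟩ hy
    obtain ⟨h4, h5⟩ := ih h3 hy
    obtain ⟨h6, h7⟩ := key h1 (back _ _ _ h2 h5)
    exact ⟨Reach.tau_left h6 ((vis _ _ _ h2 h5).append h4), h7⟩

theorem infReach_iff {s : L.State} {ξ : ℕ → Act} :
    L.InfReach s ξ ↔ ∃ p : ℕ → L.State, p 0 = s ∧ ∀ i, L.Reach (p i) [ξ i] (p (i + 1)) := by
  constructor
  · rintro ⟨p, q, h0, h⟩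
    exact ⟨p, h0, fun i => ⟨q i, p (i + 1), (h i).1, (h i).2, Relation.ReflTransGen.refl⟩⟩
  · rintro ⟨p, h0, h⟩
    choose t t' h1 h2 h3 using h
    refine ⟨fun i => Nat.casesOn i s t', t, rfl, fun i => ⟨?_, h2 i⟩⟩
    cases i with
    | zero => simpa [← h0] using h1 0
    | succ i => exact Relation.ReflTransGen.trans (h3 i) (h1 (i + 1))

/-- Dependent choice along the invariant `I`. -/
theorem infReach_of_forall_exists {ξ : ℕ → Act} (I : ℕ → L.State → Prop)
    (hI : ∀ n s, I n s → ∃ s', L.Reach s [ξ n] s' ∧ I (n + 1) s') {s : L.State} (h0 : I 0 s) :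
    L.InfReach s ξ := by
  choose! g hg hg' using hI
  let p : ℕ → L.State := fun n => Nat.rec s (fun n x => g n x) n
  have hp : ∀ n, I n (p n) := by
    intro n
    induction n with
    | zero => exact h0
    | succ n ih => exact hg' n _ ih
  exact infReach_iff.2 ⟨p, rfl, fun i => hg i _ (hp i)⟩

theorem map_range_succ (ξ : ℕ → Act) (n : ℕ) :
    (List.range (n + 1)).map ξ = (List.range n).map ξ ++ [ξ n] := by
  simp [List.range_succ]

theorem reach_map_range {p : ℕ → L.State} {ξ : ℕ → Act}
    (h : ∀ i, L.Reach (p i) [ξ i] (p (i + 1))) (n : ℕ) :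
    L.Reach (p 0) ((List.range n).map ξ) (p n) := by
  induction n with
  | zero => exact Reach.refl _
  | succ n ih =>
    rw [map_range_succ]
    exact ih.append (h n)

theorem InfReach.append {s t : L.State} {ξ : ℕ → Act} {n : ℕ}
    (h : L.Reach s ((List.range n).map ξ) t) (h' : L.InfReach t fun i => ξ (n + i)) :
    L.InfReach s ξ := by
  induction n generalizing t with
  | zero =>
    obtain ⟨p, q, h0, hpq⟩ := h'
    -- Only the starting point changes: the τ-path from `s` is absorbed into the first block.
    refine ⟨fun i => Nat.casesOn i s fun j => p (j + 1), q, rfl, fun i => ?_⟩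
    have := hpq i
    simp only [Nat.zero_add] at this
    refine ⟨?_, this.2⟩
    cases i with
    | zero => exact Relation.ReflTransGen.trans h (h0 ▸ this.1)
    | succ i => exact this.1
  | succ n ih =>
    rw [map_range_succ, reach_append] at h
    obtain ⟨x, h1, h2⟩ := h
    obtain ⟨p, h0, hp⟩ := infReach_iff.1 h'
    refine ih h1 (infReach_iff.2 ⟨fun i => Nat.casesOn i x p, rfl, fun i => ?_⟩)
    cases i with
    | zero => simpa [h0] using h2
    | succ i => simpa [Nat.add_assoc, Nat.add_comm 1 i] using hp i

theorem InfReach.map {ξ : ℕ → Act} (f : L.State → M.State)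
    (tau : ∀ x y, L.trans x none y → M.TauReach (f x) (f y))
    (vis : ∀ x a y, L.trans x (some a) y → M.Reach (f x) [a] (f y)) {s : L.State}
    (h : L.InfReach s ξ) : M.InfReach (f s) ξ := by
  obtain ⟨p, h0, hp⟩ := infReach_iff.1 h
  exact infReach_iff.2 ⟨f ∘ p, by simp [h0], fun i =>
    (Reach.map f (fun _ => True) (fun _ _ _ _ _ => trivial) (fun x y h _ => tau x y h)
      (fun x a y h _ => vis x a y h) (hp i) trivial).1⟩

theorem Inf.mem_Tr {ξ : ℕ → Act} (h : ξ ∈ L.Inf) (n : ℕ) : (List.range n).map ξ ∈ L.Tr := by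
  obtain ⟨p, h0, hp⟩ := infReach_iff.1 h
  exact ⟨p n, h0 ▸ reach_map_range hp n⟩

theorem Div_subset_Tr : L.Div ⊆ L.Tr := fun _ ⟨s, h, _⟩ => ⟨s, h⟩

/-- The states without an infinite sequence of `τ`-transitions. -/
def Converges (L : LTS.{u, v} Act) : L.State → Prop :=
  Acc fun y x => L.trans x none y

theorem not_diverges_iff {s : L.State} : ¬ L.Diverges s ↔ L.Converges s := by
  rw [Converges, ← not_iff_not, not_not, not_acc_iff_exists_descending_chain]
  rfl

theorem converges_of_not_mem_Div {σ : List Act} {s : L.State} (h : L.Reach L.init σ s)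
    (hσ : σ ∉ L.Div) : L.Converges s :=
  not_diverges_iff.1 fun hs => hσ ⟨s, h, hs⟩

end Executions

/-! ### Controlled products -/

/-- A controller: a transition from `n` to `n'` with labels `k` and `l` makes the controlled
LTS perform `k` (nothing, if `k = none`), and shows `l` to the outside. -/
structure Controller (Act : Type u) : Type (max u (v + 1)) where
  State : Type v
  alphabet : Set Act
  trans : State → Option Act → Option Act → State → Prop
  init : State
  trans_mem : ∀ {n : State} {k : Option Act} {b : Act} {n' : State},
    trans n k (some b) n' → b ∈ alphabet

/-- The product of an LTS with a controller. -/
def control (A : LTS.{u, v} Act) (N : Controller.{u, v} Act) : LTS.{u, v} Act where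
  State := A.State × N.State
  alphabet := N.alphabet
  trans p l p' :=
    (l = none ∧ A.trans p.1 none p'.1 ∧ p'.2 = p.2) ∨
    (N.trans p.2 none l p'.2 ∧ p'.1 = p.1) ∨
    ∃ a, A.trans p.1 (some a) p'.1 ∧ N.trans p.2 (some a) l p'.2
  init := (A.init, N.init)
  trans_mem := by
    rintro p b p' (⟨h, -⟩ | ⟨h, -⟩ | ⟨a, -, h⟩)
    · cases h
    · exact N.trans_mem h
    · exact N.trans_mem h

section Control

variable (e : Option Act × Option Act → Act)

/-- The renaming of `a` to the codes of all pairs `(a, l)` with `l` admitted by `N`. -/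
def encodeRel (N : Controller.{u, v} Act) : Set (Act × Act) :=
  {x | ∃ l, (∀ b, l = some b → b ∈ N.alphabet) ∧ x.2 = e (some x.1, l)}

/-- The renaming of the code of a pair `(k, b)` to `b`. -/
def decodeRel : Set (Act × Act) :=
  {x | ∃ k, x.1 = e (k, some x.2)}

/-- A controller as an LTS over codes of pairs. -/
def encodeController (N : Controller.{u, v} Act) : LTS.{u, v} Act where
  State := N.State
  alphabet := {c | ∃ k l, (∀ b, l = some b → b ∈ N.alphabet) ∧ c = e (k, l)}
  trans n c n' := ∃ k l, c = some (e (k, l)) ∧ N.trans n k l n'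
  init := N.init
  trans_mem := by
    rintro n c n' ⟨k, l, h, h'⟩
    cases h
    exact ⟨k, l, fun b hb => N.trans_mem (hb ▸ h'), rfl⟩

/-- The product with a controller, expressed by the four operators. -/
def controlContext (N : Controller.{u, v} Act) (A : LTS.{u, v} Act) : LTS.{u, v} Act :=
  (((A.rename (encodeRel e N)).par (encodeController e N)).hide
    {c | ∃ k, c = e (k, none)}).rename (decodeRel e)

theorem mk_congr {S : Type v} {al al' : Set Act} {tr tr' : S → Option Act → S → Prop} {i : S}
    {h : ∀ {s : S} {a : Act} {s' : S}, tr s (some a) s' → a ∈ al}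
    {h' : ∀ {s : S} {a : Act} {s' : S}, tr' s (some a) s' → a ∈ al'}
    (hal : al = al') (htr : tr = tr') :
    (LTS.mk S al tr i h : LTS.{u, v} Act) = LTS.mk S al' tr' i h' := by
  subst hal htr
  rfl

variable {e}

theorem renames_encodeRel {N : Controller.{u, v} Act} {a b : Act} :
    Renames (encodeRel e N) a b ↔
      ∃ l, (∀ b, l = some b → b ∈ N.alphabet) ∧ b = e (some a, l) := by
  constructor
  · rintro (h | ⟨-, h⟩)
    · exact h
    · exact absurd ⟨none, by simp, rfl⟩ (h (e (some a, none)))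
  · exact fun h => Or.inl h

theorem renames_decodeRel (he : Function.Injective e) {k : Option Act} {b c : Act} :
    Renames (decodeRel e) (e (k, some b)) c ↔ c = b := by
  constructor
  · rintro (⟨k', h⟩ | ⟨-, h⟩)
    · have := he h
      simp_all
    · exact absurd ⟨k, rfl⟩ (h b)
  · rintro rfl
    exact Or.inl ⟨k, rfl⟩

/-- The code of `(k, l)` stands for "perform `k`, show `l`". Renaming each `a` to all its codes
leaves the choice of `l` to the controller. Every visible action of the renamed `A` must
synchronize, since the controller's alphabet contains all these codes. Hiding and decoding then turn
a code into `l`. -/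
theorem controlContext_eq (he : Function.Injective e) (N : Controller.{u, v} Act)
    (A : LTS.{u, v} Act)
    (hN : ∀ n a l n', N.trans n (some a) l n' → a ∈ A.alphabet) :
    controlContext e N A = A.control N := by
  have hall : (A.rename (encodeRel e N)).alphabet ⊆ (encodeController e N).alphabet := by
    rintro c ⟨a, -, h⟩
    obtain ⟨l, hl, rfl⟩ := renames_encodeRel.1 h
    exact ⟨_, l, hl, rfl⟩
  refine mk_congr (h := (controlContext e N A).trans_mem) (h' := (A.control N).trans_mem) ?_ ?_
  · ext b
    constructor
    · rintro ⟨c, ⟨hc, hc'⟩, h⟩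
      have : c ∈ (encodeController e N).alphabet := hc.elim (fun h => hall h) id
      obtain ⟨k, l, hl, rfl⟩ := this
      cases l with
      | none => exact absurd ⟨k, rfl⟩ hc'
      | some b' =>
        rw [renames_decodeRel he] at h
        exact h ▸ hl b' rfl
    · intro hb
      refine ⟨e (none, some b), ⟨Or.inr ⟨none, some b, ?_, rfl⟩, ?_⟩,
        (renames_decodeRel he).2 rfl⟩
      · rintro _ ⟨⟩
        exact hb
      · rintro ⟨k, hk⟩
        have := he hk
        simp at this
  · funext p l p'
    apply propext
    constructor
    · rintro ⟨l', ⟨c, hc, hl'⟩, hl⟩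
      have out : ∀ k l₀, c = some (e (k, l₀)) → l = l₀ := by
        rintro k l₀ rfl
        cases l₀ with
        | none =>
          have : l' = none := by
            rcases hl' with ⟨-, h⟩ | ⟨h, -⟩
            · exact absurd rfl (h _ ⟨k, rfl⟩)
            · exact h
          subst this
          rcases hl with ⟨-, h⟩ | ⟨a, b, h, -⟩
          · exact h
          · cases h
        | some b =>
          have : l' = some (e (k, some b)) := by
            rcases hl' with ⟨h, -⟩ | ⟨-, b', ⟨k', rfl⟩, h⟩
            · exact h
            · have := he (Option.some.inj h)
              simp at this
          subst this
          rcases hl with ⟨h, -⟩ | ⟨a, b', h, h', h''⟩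
          · cases h
          · cases h
            rw [renames_decodeRel he] at h''
            rw [h', h'']
      -- `A` alone can only perform τ; the controller alone can only use codes with `k = none`,
      -- because `hN` puts all its other codes into the alphabet of the renamed `A`.
      rcases hc with ⟨hc, ⟨k, hk, hr⟩, hp⟩ | ⟨hc, ⟨k, l₀, rfl, h⟩, hp⟩ |
        ⟨-, ⟨k, hk, hr⟩, k', l₀, rfl, h⟩
      · rcases hr with ⟨rfl, rfl⟩ | ⟨a, b, rfl, rfl, hr⟩
        · refine Or.inl ⟨?_, hk, hp⟩
          rcases hl' with ⟨rfl, -⟩ | ⟨-, b, -, h⟩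
          · rcases hl with ⟨-, h⟩ | ⟨a, b, h, -⟩
            · exact h
            · cases h
          · cases h
        · obtain ⟨l₀, hl₀, rfl⟩ := renames_encodeRel.1 hr
          exact absurd rfl (hc _ ⟨_, l₀, hl₀, rfl⟩)
      · obtain rfl := out k l₀ rfl
        cases k with
        | none => exact Or.inr (Or.inl ⟨h, hp⟩)
        | some a =>
          refine absurd rfl (hc _ ⟨a, hN _ _ _ _ h, renames_encodeRel.2 ⟨l, ?_, rfl⟩⟩)
          rintro b rfl
          exact N.trans_mem h
      · rcases hr with ⟨-, h'⟩ | ⟨a, b, rfl, hb, hr⟩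
        · cases h'
        · obtain rfl := out k' l₀ rfl
          obtain ⟨l₁, hl₁, rfl⟩ := renames_encodeRel.1 hr
          have := he (Option.some.inj hb)
          simp only [Prod.mk.injEq] at this
          obtain ⟨rfl, rfl⟩ := this
          exact Or.inr (Or.inr ⟨a, hk, h⟩)
    · have out : ∀ k, ∃ l', ((l' = some (e (k, l)) ∧
          ∀ b ∈ {c | ∃ k, c = e (k, none)}, some (e (k, l)) ≠ some b) ∨
          (l' = none ∧ ∃ b ∈ {c | ∃ k, c = e (k, none)}, some (e (k, l)) = some b)) ∧
          RenamesLabel (decodeRel e) l' l := by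
        intro k
        cases l with
        | none => exact ⟨none, Or.inr ⟨rfl, _, ⟨k, rfl⟩, rfl⟩, Or.inl ⟨rfl, rfl⟩⟩
        | some b =>
          refine ⟨_, Or.inl ⟨rfl, ?_⟩, Or.inr ⟨_, b, rfl, rfl, (renames_decodeRel he).2 rfl⟩⟩
          rintro _ ⟨k', rfl⟩ h
          have := he (Option.some.inj h)
          simp at this
      rintro (⟨rfl, h, hp⟩ | ⟨h, hp⟩ | ⟨a, h, h'⟩)
      · exact ⟨none, ⟨none, Or.inl ⟨by simp, ⟨none, h, Or.inl ⟨rfl, rfl⟩⟩, hp⟩,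
          Or.inl ⟨rfl, by simp⟩⟩, Or.inl ⟨rfl, rfl⟩⟩
      · obtain ⟨l', h1, h2⟩ := out none
        refine ⟨l', ⟨some (e (none, l)), Or.inr (Or.inl ⟨?_, ⟨none, l, rfl, h⟩, hp⟩), h1⟩, h2⟩
        rintro b ⟨a, -, hab⟩ hb
        obtain ⟨l₁, -, rfl⟩ := renames_encodeRel.1 hab
        have := he (Option.some.inj hb)
        simp at this
      · obtain ⟨l', h1, h2⟩ := out (some a)
        have hmem : ∀ b, l = some b → b ∈ N.alphabet := by
          rintro b rfl
          exact N.trans_mem h'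
        have hr : Renames (encodeRel e N) a (e (some a, l)) :=
          renames_encodeRel.2 ⟨l, hmem, rfl⟩
        exact ⟨l', ⟨some (e (some a, l)), Or.inr (Or.inr
          ⟨⟨_, ⟨⟨a, A.trans_mem h, hr⟩, ⟨_, l, hmem, rfl⟩⟩, rfl⟩,
            ⟨some a, h, Or.inr ⟨a, _, rfl, rfl, hr⟩⟩, ⟨_, l, rfl, h'⟩⟩), h1⟩, h2⟩

theorem exists_injective_pair [Infinite Act] :
    ∃ e : Option Act × Option Act → Act, Function.Injective e := by
  have : Cardinal.mk (Option Act × Option Act) = Cardinal.mk Act := by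
    have h : Cardinal.mk (Option Act) = Cardinal.mk Act := by
      rw [Cardinal.mk_option, Cardinal.add_one_eq (Cardinal.aleph0_le_mk Act)]
    rw [Cardinal.mk_prod, Cardinal.lift_id, h, Cardinal.mul_eq_self (Cardinal.aleph0_le_mk Act)]
  obtain ⟨f⟩ := Cardinal.eq.1 this
  exact ⟨f, f.injective⟩

/-- Congruences are compatible with controlled products. -/
theorem IsCongruence.control [Infinite Act] {r : LTS.{u, v} Act → LTS.{u, v} Act → Prop}
    (hr : IsCongruence r) {A A' : LTS.{u, v} Act} (h : r A A') (hal : A.alphabet = A'.alphabet)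
    (N : Controller.{u, v} Act)
    (hN : ∀ n a l n', N.trans n (some a) l n' → a ∈ A.alphabet) :
    r (A.control N) (A'.control N) := by
  obtain ⟨e, he⟩ := exists_injective_pair (Act := Act)
  rw [← controlContext_eq he N A hN, ← controlContext_eq he N A' (hal ▸ hN)]
  exact hr.rename _ (hr.hide _ (hr.par_right _ (hr.rename _ h)))

end Control

/-! ### Preservation of alphabets and of always-nondivergent infinite traces -/

section Preservation

/-- The LTS with one state and a loop labelled `a`. -/
def loop (a : Act) : LTS.{u, v} Act where
  State := PUnit
  alphabet := {a}
  trans _ l _ := l = some a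
  init := PUnit.unit
  trans_mem := by
    rintro _ b _ h
    exact Option.some.inj h

variable {r : LTS.{u, v} Act → LTS.{u, v} Act → Prop}

/-- If `a` is missing from the alphabet of `L'`, the loop performs `a` freely beside `L'`. Beside
`L` it must synchronize, so `[a]` is a trace of `L`, hence of `L'`, which is absurd. -/
theorem IsCongruence.alphabet_subset (hr : IsCongruence r) (hTr : Preserves r Tr)
    {L L' : LTS.{u, v} Act} (h : r L L') : L.alphabet ⊆ L'.alphabet := by
  intro a ha
  by_contra ha'
  have h1 : [a] ∈ (L'.par (loop a)).Tr :=
    ⟨(L'.init, PUnit.unit), Reach.of_trans (Or.inr (Or.inl ⟨by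
      rintro b hb h
      exact ha' (Option.some.inj h ▸ hb), rfl, rfl⟩))⟩
  rw [← hTr (hr.par_right (loop a) h)] at h1
  obtain ⟨s, hs⟩ := h1
  obtain ⟨t, t', ht, htt, -⟩ := hs
  have hτ : ∀ x y, Relation.ReflTransGen
      (fun s s' => (L.par (loop a)).trans s none s') x y → L.TauReach x.1 y.1 := by
    intro x y h
    induction h with
    | refl => exact Relation.ReflTransGen.refl
    | tail _ h ih =>
      rcases h with ⟨-, h, -⟩ | ⟨-, h, -⟩ | ⟨⟨b, -, h⟩, -⟩
      · exact Relation.ReflTransGen.tail ih h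
      · cases h
      · cases h
  have h2 : [a] ∈ L.Tr := by
    rcases htt with ⟨h, -⟩ | ⟨h, -⟩ | ⟨-, h, -⟩
    · exact absurd rfl (h a rfl)
    · exact absurd rfl (h a ha)
    · exact ⟨t'.1, t.1, t'.1, hτ _ _ ht, h, Relation.ReflTransGen.refl⟩
  rw [hTr h] at h2
  obtain ⟨s, hs⟩ := h2
  exact ha' (hs.mem_alphabet a (by simp))

theorem IsCongruence.alphabet_eq (hr : IsCongruence r) (hTr : Preserves r Tr)
    {L L' : LTS.{u, v} Act} (h : r L L') : L.alphabet = L'.alphabet :=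
  (hr.alphabet_subset hTr h).antisymm (hr.alphabet_subset hTr (hr.equivalence.symm h))

/-- Every divergence trace has a minimal divergence trace as a prefix. -/
theorem exists_minD_prefix {L : LTS.{u, v} Act} {σ : List Act} (h : σ ∈ L.Div) :
    ∃ n ≤ σ.length, σ.take n ∈ L.minD := by
  classical
  have hex : ∃ n, σ.take n ∈ L.Div := ⟨σ.length, by simpa using h⟩
  refine ⟨Nat.find hex, Nat.find_min' hex (by simpa using h), Nat.find_spec hex, ?_⟩
  intro i hi
  rw [List.length_take] at hi
  rw [List.take_take, min_eq_left (by omega)]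
  exact Nat.find_min hex (by omega)

/-- The controller that makes the controlled LTS perform `ξ`, showing nothing. -/
def follow (ξ : ℕ → Act) : Controller.{u, v} Act where
  State := ULift ℕ
  alphabet := ∅
  trans n k l n' := k = some (ξ n.down) ∧ l = none ∧ n'.down = n.down + 1
  init := ⟨0⟩
  trans_mem := by
    rintro _ _ _ _ ⟨-, h, -⟩
    cases h

theorem nil_mem_Div_control_follow {L : LTS.{u, v} Act} {ξ : ℕ → Act} (h : ξ ∈ L.Inf) :
    [] ∈ (L.control (follow ξ)).Div := by
  obtain ⟨p, q, h0, hpq⟩ := h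
  refine ⟨_, Reach.refl _, ?_⟩
  by_contra hdiv
  have hacc := not_diverges_iff.1 hdiv
  have htau : ∀ n x y, L.TauReach x y →
      (L.control (follow ξ)).TauReach (x, (⟨n⟩ : ULift ℕ)) (y, (⟨n⟩ : ULift ℕ)) := by
    intro n x y hxy
    induction hxy with
    | refl => exact Relation.ReflTransGen.refl
    | tail _ h ih => exact Relation.ReflTransGen.tail ih (Or.inl ⟨rfl, h, rfl⟩)
  -- With `TransGen`, a single descent crosses a whole block: the τ-moves from `p n` to `q n` and
  -- the hidden action `ξ n`.
  have key : ∀ x, Acc (Relation.TransGen fun y x => (L.control (follow ξ)).trans x none y) x →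
      ∀ n, x ≠ (p n, (⟨n⟩ : ULift ℕ)) := by
    intro x hx
    induction hx with
    | intro x _ ih =>
      rintro n rfl
      refine ih (p (n + 1), (⟨n + 1⟩ : ULift ℕ)) ?_ (n + 1) rfl
      have h1 := htau n _ _ (hpq n).1
      have h2 : (L.control (follow ξ)).trans (q n, (⟨n⟩ : ULift ℕ)) none
          (p (n + 1), (⟨n + 1⟩ : ULift ℕ)) :=
        Or.inr (Or.inr ⟨ξ n, (hpq n).2, rfl, rfl, rfl⟩)
      exact Relation.transGen_swap.1 (Relation.TransGen.tail' h1 h2)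
  exact key _ hacc.transGen 0 (by rw [h0]; rfl)

/-- The controller's counter records how much of `ξ` has been performed. On an infinite τ-path it
either grows forever, giving `ξ ∈ L.Inf`, or stops, giving a divergence after a prefix of `ξ`. -/
theorem control_follow_converges {L : LTS.{u, v} Act} {ξ : ℕ → Act} (h : ξ ∉ L.Inf)
    (hξ : ∀ n, (List.range n).map ξ ∉ L.Div) : [] ∉ (L.control (follow ξ)).Div := by
  rintro ⟨x, hx, p, h0, hp⟩
  have inv : ∀ x y, (L.control (follow ξ)).trans x none y →
      L.Reach L.init ((List.range x.2.down).map ξ) x.1 →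
      L.Reach L.init ((List.range y.2.down).map ξ) y.1 := by
    rintro ⟨s, n⟩ ⟨s', n'⟩ (⟨-, h1, h2⟩ | ⟨⟨h1, -⟩, -⟩ | ⟨a, h1, h2, -, h3⟩) hx
    · exact (congrArg ULift.down h2) ▸ hx.tau_right h1
    · cases h1
    · cases h2
      have h3 : n'.down = n.down + 1 := h3
      change L.Reach L.init ((List.range n'.down).map ξ) s'
      rw [h3, map_range_succ]
      exact hx.trans_right h1
  have hreach : ∀ x, (L.control (follow ξ)).TauReach (L.control (follow ξ)).init x →
      L.Reach L.init ((List.range x.2.down).map ξ) x.1 := by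
    intro x hx
    induction hx with
    | refl => exact Reach.refl _
    | tail _ h ih => exact inv _ _ h ih
  have hpr : ∀ i, L.Reach L.init ((List.range (p i).2.down).map ξ) (p i).1 := by
    intro i
    induction i with
    | zero => exact h0 ▸ hreach _ hx
    | succ i ih => exact inv _ _ (hp i) ih
  have next : ∀ i, ∃ j, L.Reach (p i).1 [ξ (p i).2.down] (p j).1 ∧
      (p j).2.down = (p i).2.down + 1 := by
    intro i
    by_contra hno
    -- If the counter never advances after `p i`, the rest of the path is a τ-path of `L`.
    have hstep : ∀ j, L.TauReach (p i).1 (p (i + j)).1 ∧ (p (i + j)).2 = (p i).2 ∧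
        L.trans (p (i + j)).1 none (p (i + j + 1)).1 := by
      have aux : ∀ j, L.TauReach (p i).1 (p (i + j)).1 → (p (i + j)).2 = (p i).2 →
          L.trans (p (i + j)).1 none (p (i + j + 1)).1 ∧
            (p (i + j + 1)).2 = (p (i + j)).2 := by
        intro j h1 h2
        rcases hp (i + j) with ⟨-, h3, h4⟩ | ⟨⟨h3, -⟩, -⟩ | ⟨a, h3, h4, -, h5⟩
        · exact ⟨h3, h4⟩
        · cases h3
        · cases h4
          rw [h2] at h3 h5
          exact absurd ⟨_, ⟨_, _, h1, h3, Relation.ReflTransGen.refl⟩, h5⟩ hno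
      intro j
      induction j with
      | zero => exact ⟨Relation.ReflTransGen.refl, rfl,
          (aux 0 Relation.ReflTransGen.refl rfl).1⟩
      | succ j ih =>
        obtain ⟨h1, h2, h3⟩ := ih
        have h4 := h1.tail h3
        have h5 := (aux j h1 h2).2.trans h2
        exact ⟨h4, h5, (aux (j + 1) h4 h5).1⟩
    exact hξ _ ⟨_, hpr i, fun j => (p (i + j)).1, rfl, fun j => (hstep j).2.2⟩
  have hinf : L.InfReach (p 0).1 fun i => ξ ((p 0).2.down + i) := by
    refine infReach_of_forall_exists
      (fun n s => ∃ i, s = (p i).1 ∧ (p i).2.down = (p 0).2.down + n) ?_ ⟨0, rfl, rfl⟩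
    rintro n _ ⟨i, rfl, hi⟩
    obtain ⟨j, hj, hj'⟩ := next i
    exact ⟨_, hi ▸ hj, j, rfl, by omega⟩
  exact h (InfReach.append (hpr 0) hinf)

theorem IsCongruence.anI_subset [Infinite Act] (hr : IsCongruence r) (hTr : Preserves r Tr)
    (hminD : Preserves r minD) {L L' : LTS.{u, v} Act} (h : r L L') : L.anI ⊆ L'.anI := by
  rintro ξ ⟨hξ, hext⟩
  have hal := hr.alphabet_eq hTr h
  have hmem : ∀ j, ξ j ∈ L.alphabet := fun j =>
    let ⟨_, hs⟩ := Inf.mem_Tr hξ (j + 1)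
    hs.mem_alphabet _ (by simp [List.range_succ])
  have hext' : ξ ∉ L'.extI := by
    rintro ⟨-, i, hi⟩
    exact hext ⟨hmem, i, hminD h ▸ hi⟩
  refine ⟨?_, hext'⟩
  by_contra hξ'
  have hdiv : ∀ n, (List.range n).map ξ ∉ L'.Div := by
    intro n hn
    obtain ⟨m, hm, hm'⟩ := exists_minD_prefix hn
    refine hext' ⟨hal ▸ hmem, m, ?_⟩
    simp only [List.length_map, List.length_range] at hm
    rwa [← List.map_take, List.take_range, min_eq_left hm] at hm'
  -- The empty trace has no proper prefix, so its divergence is automatically minimal.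
  have h1 : [] ∈ (L.control (follow ξ)).minD :=
    ⟨nil_mem_Div_control_follow hξ, by simp⟩
  rw [hminD (hr.control h hal (follow ξ) ?_)] at h1
  · exact control_follow_converges hξ' hdiv h1.1
  · rintro n a l n' ⟨h, -⟩
    cases h
    exact hmem _

theorem IsCongruence.anI_eq [Infinite Act] (hr : IsCongruence r) (hTr : Preserves r Tr)
    (hminD : Preserves r minD) {L L' : LTS.{u, v} Act} (h : r L L') : L.anI = L'.anI :=
  (hr.anI_subset hTr hminD h).antisymm (hr.anI_subset hTr hminD (hr.equivalence.symm h))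

end Preservation

/-! ### Shadow controllers -/

/-- The states reached from a set of states by one visible action. -/
def after (L : LTS.{u, v} Act) (T : Set L.State) (a : Act) : Set L.State :=
  {t | ∃ s ∈ T, L.Reach s [a] t}

/-- The states reached from the initial state by a trace. -/
def reachSet (L : LTS.{u, v} Act) (σ : List Act) : Set L.State :=
  {s | L.Reach L.init σ s}

theorem after_reachSet (L : LTS.{u, v} Act) (σ : List Act) (a : Act) :
    L.after (L.reachSet σ) a = L.reachSet (σ ++ [a]) :=
  Set.ext fun _ => reach_append.symm

/-- States of a shadow controller. -/
inductive ShadowState (S E : Type v) : Type v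
  | wait (T : Set S) (s : S)
  | run (s : S)
  | drive (e : E)

/-- The part of a shadow controller that drives the controlled LTS. -/
structure Driver (L : LTS.{u, v} Act) where
  State : Type v
  start : Set L.State → L.State → State → Prop
  trans : State → Option Act → Option Act → ShadowState L.State State → Prop
  trans_mem : ∀ {e k b m}, trans e k (some b) m → b ∈ L.alphabet

/-- Transitions of a shadow controller: it behaves like `L`, but after a divergence trace
of `L` it may decide to drive the controlled LTS, using `c` as starting signal. -/
inductive ShadowTrans (L : LTS.{u, v} Act) (D : Driver L) (c : Act) :
    ShadowState L.State D.State → Option Act → Option Act → ShadowState L.State D.State → Prop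
  | wait_tau {T s s'} (h : L.trans s none s') :
      ShadowTrans L D c (.wait T s) none none (.wait T s')
  | wait_vis {T s y s'} (h : L.trans s (some y) s') :
      ShadowTrans L D c (.wait T s) none (some y) (.wait (L.after T y) s')
  | wait_run {T s} : ShadowTrans L D c (.wait T s) none none (.run s)
  | wait_drive {T s u e} (hu : u ∈ T) (hd : L.Diverges u) (h : D.start T s e) :
      ShadowTrans L D c (.wait T s) (some c) none (.drive e)
  | run {s l s'} (h : L.trans s l s') : ShadowTrans L D c (.run s) none l (.run s')
  | drive_idle {e} : ShadowTrans L D c (.drive e) none none (.drive e)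
  | drive {e k l m} (h : D.trans e k l m) : ShadowTrans L D c (.drive e) k l m

/-- The shadow controller of `L` with a given driver. -/
def shadow (L : LTS.{u, v} Act) (D : Driver L) (c : Act) : Controller.{u, v} Act where
  State := ShadowState L.State D.State
  alphabet := L.alphabet
  trans := ShadowTrans L D c
  init := .wait (L.reachSet []) L.init
  trans_mem := by
    rintro n k b n' h
    cases h with
    | wait_vis h => exact L.trans_mem h
    | run h => exact L.trans_mem h
    | drive h => exact D.trans_mem h

/-- The product of `c.B` with a shadow controller of `L`. -/
def shadowed (L : LTS.{u, v} Act) (D : Driver L) (c : Act) (B : LTS.{u, v} Act) :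
    LTS.{u, v} Act :=
  (B.act c).control (L.shadow D c)

section Shadow

variable {L B : LTS.{u, v} Act} {D : Driver L} {c : Act}

/-- States of `shadowed`. -/
abbrev pair (L : LTS.{u, v} Act) (D : Driver L) (c : Act) (B : LTS.{u, v} Act)
    (a : Option B.State) (m : ShadowState L.State D.State) : (L.shadowed D c B).State :=
  (a, m)

theorem act_trans_none {l : Option Act} {x : Option B.State} :
    (B.act c).trans none l x ↔ l = some c ∧ x = some B.init := by
  constructor
  · rintro (⟨t, t', h, -⟩ | ⟨-, h⟩)
    · cases h
    · exact h
  · exact fun h => Or.inr ⟨rfl, h⟩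

theorem act_trans_some {t : B.State} {l : Option Act} {x : Option B.State} :
    (B.act c).trans (some t) l x ↔ ∃ t', x = some t' ∧ B.trans t l t' := by
  constructor
  · rintro (⟨t, t', h, h', h''⟩ | ⟨h, -⟩)
    · cases h
      exact ⟨t', h', h''⟩
    · cases h
  · rintro ⟨t', h, h'⟩
    exact Or.inl ⟨t, t', rfl, h, h'⟩

/-- This is the purpose of the prefix `c`: the τ-moves of `B` cannot occur before driving starts. -/
theorem converges_act_none : (B.act c).Converges none := by
  refine ⟨_, fun x hx => ?_⟩
  cases (act_trans_none.1 hx).1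

theorem converges_act_some {t : B.State} (h : B.Converges t) :
    (B.act c).Converges (some t) := by
  induction h with
  | intro t _ ih =>
    refine ⟨_, fun x hx => ?_⟩
    obtain ⟨t', rfl, h⟩ := act_trans_some.1 hx
    exact ih t' h

theorem shadowed_run {a : Option B.State} {s s' : L.State} {l : Option Act}
    (h : L.trans s l s') :
    (L.shadowed D c B).trans (pair L D c B a (.run s)) l (pair L D c B a (.run s')) :=
  Or.inr (Or.inl ⟨.run h, rfl⟩)

theorem shadowed_reach_run {a : Option B.State} {s s' : L.State} {σ : List Act}
    (h : L.Reach s σ s') :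
    (L.shadowed D c B).Reach (pair L D c B a (.run s)) σ (pair L D c B a (.run s')) :=
  (Reach.map (M := L.shadowed D c B) (fun s => pair L D c B a (.run s)) (fun _ => True)
    (fun _ _ _ _ _ => trivial) (fun _ _ h _ => Relation.ReflTransGen.single (shadowed_run h))
    (fun _ _ _ h _ => Reach.of_trans (shadowed_run h)) h trivial).1

theorem shadowed_init_run : (L.shadowed D c B).TauReach (L.shadowed D c B).init
    (pair L D c B none (.run L.init)) :=
  Relation.ReflTransGen.single (Or.inr (Or.inl ⟨.wait_run, rfl⟩))

/-- The first argument of `wait` performs the subset construction. Hence the guard of `wait_drive`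
says exactly that the trace so far is in `L.Div`, even if `s` itself does not diverge. -/
theorem shadowed_reach_wait {s : L.State} {σ : List Act} (h : L.Reach L.init σ s) :
    (L.shadowed D c B).Reach (L.shadowed D c B).init σ
      (pair L D c B none (.wait (L.reachSet σ) s)) := by
  refine Reach.rec_right (L := L) (σ₀ := []) (motive := fun σ s =>
    (L.shadowed D c B).Reach (L.shadowed D c B).init σ
      (pair L D c B none (.wait (L.reachSet σ) s))) ?_ ?_ (Reach.refl _) h
  · intro σ s s' ih h
    exact ih.tau_right (Or.inr (Or.inl ⟨.wait_tau h, rfl⟩))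
  · intro σ s y s' ih h
    refine ih.trans_right (Or.inr (Or.inl ⟨?_, rfl⟩))
    exact after_reachSet L σ y ▸ .wait_vis h

theorem Inf_subset_shadowed : L.Inf ⊆ (L.shadowed D c B).Inf := by
  intro ξ hξ
  have h : (L.shadowed D c B).InfReach (pair L D c B none (.run L.init)) ξ :=
    InfReach.map (fun s => pair L D c B none (.run s))
      (fun _ _ h => Relation.ReflTransGen.single (shadowed_run h))
      (fun _ _ _ h => Reach.of_trans (shadowed_run h)) hξ
  exact InfReach.append (n := 0) shadowed_init_run (by simpa using h)

theorem Div_subset_shadowed : L.Div ⊆ (L.shadowed D c B).Div := by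
  rintro σ ⟨s, hs, p, h0, hp⟩
  exact ⟨_, (shadowed_reach_run hs).tau_left shadowed_init_run,
    fun i => pair L D c B none (.run (p i)), congrArg (fun s => pair L D c B none (.run s)) h0, fun i => shadowed_run (hp i)⟩

/-- Waiting states are unstable by `wait_run` and driving states by `drive_idle`, so only running
states yield stable failures. They refuse no more than the state of `L` they carry, and running
without having driven gives all failures of `L`. -/
theorem Sf_shadowed (hrun : ∀ σ a s, (L.shadowed D c B).Reach (L.shadowed D c B).init σ
    (pair L D c B a (.run s)) → L.Reach L.init σ s) : (L.shadowed D c B).Sf = L.Sf := by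
  ext ⟨σ, A⟩
  constructor
  · rintro ⟨hA, ⟨a, m⟩, h, hτ, hA'⟩
    refine ⟨hA, ?_⟩
    cases m with
    | wait T s =>
      exact absurd (Or.inr (Or.inl ⟨.wait_run, rfl⟩)) (hτ (pair L D c B a (.run s)))
    | drive e =>
      exact absurd (Or.inr (Or.inl ⟨.drive_idle, rfl⟩)) (hτ (pair L D c B a (.drive e)))
    | run s =>
      exact ⟨s, hrun _ _ _ h, fun s' h => hτ _ (shadowed_run h),
        fun b hb s' h => hA' b hb _ (shadowed_run h)⟩
  · rintro ⟨hA, s, h, hτ, hA'⟩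
    refine ⟨hA, pair L D c B none (.run s), (shadowed_reach_run h).tau_left shadowed_init_run,
      ?_, ?_⟩
    · rintro ⟨a, m⟩ (⟨-, h, -⟩ | ⟨h, -⟩ | ⟨x, -, h⟩)
      · cases (act_trans_none.1 h).1
      · cases h with
        | run h => exact hτ _ h
      · cases h
    · rintro b hb ⟨a, m⟩ (⟨h, -⟩ | ⟨h, -⟩ | ⟨x, -, h⟩)
      · cases h
      · cases h with
        | run h => exact hA' b hb _ h
      · cases h

/-- The two components take their τ-moves independently, so nested well-founded induction applies.
-/
theorem shadowed_converges_run {a : Option B.State} {s : L.State}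
    (ha : (B.act c).Converges a) (hs : L.Converges s) :
    (L.shadowed D c B).Converges (pair L D c B a (.run s)) := by
  induction ha generalizing s with
  | intro a ha iha =>
    induction hs with
    | intro s _ ihs =>
      refine ⟨_, ?_⟩
      rintro ⟨a', m⟩ (⟨-, h, rfl⟩ | ⟨h, rfl⟩ | ⟨x, -, h⟩)
      · exact iha a' h ⟨_, by assumption⟩
      · cases h with
        | run h => exact ihs _ h
      · cases h

theorem shadowed_converges_wait {T : Set L.State} {s : L.State}
    (hT : ∀ u ∈ T, ¬ L.Diverges u) (hs : L.Converges s) :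
    (L.shadowed D c B).Converges (pair L D c B none (.wait T s)) := by
  induction hs with
  | intro s hs ih =>
    refine ⟨_, ?_⟩
    rintro ⟨a', m⟩ (⟨-, h, -⟩ | ⟨h, rfl⟩ | ⟨x, -, h⟩)
    · cases (act_trans_none.1 h).1
    · cases h with
      | wait_tau h => exact ih _ h
      | wait_run => exact shadowed_converges_run converges_act_none ⟨_, hs⟩
    · cases h with
      | wait_drive hu hd _ => exact absurd hd (hT _ hu)

/-- Traces with a divergence trace as a prefix. -/
def extD (L : LTS.{u, v} Act) : Set (List Act) :=
  {σ | σ ∈ L.Tr ∧ ∃ π ∈ L.Div, π <+: σ}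

theorem Div_subset_extD : L.Div ⊆ L.extD := fun σ h =>
  ⟨Div_subset_Tr h, σ, h, List.prefix_refl _⟩

theorem extD_append {σ ρ : List Act} (h : σ ∈ L.extD) (h' : σ ++ ρ ∈ L.Tr) :
    σ ++ ρ ∈ L.extD := by
  obtain ⟨-, π, hπ, hp⟩ := h
  exact ⟨h', π, hπ, hp.trans (List.prefix_append _ _)⟩

end Shadow

/-! ### Invariants of executions -/

theorem Reach.step {L : LTS.{u, v} Act} {s t u : L.State} {σ : List Act} {l : Option Act}
    (h : L.Reach s σ t) (h' : L.trans t l u) : L.Reach s (σ ++ l.toList) u := by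
  cases l with
  | none => simpa using h.tau_right h'
  | some a => exact h.trans_right h'

theorem Reach.invariant {L : LTS.{u, v} Act} (I : List Act → L.State → Prop)
    (h0 : I [] L.init) (hI : ∀ σ s l s', I σ s → L.trans s l s' → I (σ ++ l.toList) s')
    {σ : List Act} {s : L.State} (h : L.Reach L.init σ s) : I σ s :=
  Reach.rec_right (motive := I) (σ₀ := [])
    (fun σ s s' ih h => by simpa using hI σ s none s' ih h)
    (fun σ s a s' ih h => hI σ s (some a) s' ih h) h0 h

/-! ### Adding divergence traces -/

section AddDiv

variable (L : LTS.{u, v} Act) (κ : List Act) (x : Act)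

/-- The driver that performs `κ`, showing nothing, and then `x`, showing a visible action of
`L`. -/
def divDriver : Driver L where
  State := ℕ × L.State
  start _ s e := e = (0, s)
  trans e k l m :=
    (∃ a, κ[e.1]? = some a ∧ k = some a ∧ l = none ∧ m = .drive (e.1 + 1, e.2)) ∨
    (e.1 = κ.length ∧ k = some x ∧ ∃ y s', l = some y ∧ L.trans e.2 (some y) s' ∧ m = .run s')
  trans_mem := by
    rintro e k b m (⟨a, -, -, h, -⟩ | ⟨-, -, y, s', h, h', -⟩)
    · cases h
    · cases h
      exact L.trans_mem h'

/-- Invariant of the product with the driver `divDriver`. -/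
def divInvariant (B : LTS.{u, v} Act) (σ : List Act) (a : Option B.State) :
    ShadowState L.State (ℕ × L.State) → Prop
  | .wait T s => a = none ∧ T = L.reachSet σ ∧ L.Reach L.init σ s
  | .run s => L.Reach L.init σ s ∧
      (a = none ∨ ∃ t, a = some t ∧ B.Reach B.init (κ ++ [x]) t ∧ σ ∈ L.extD)
  | .drive e => L.Reach L.init σ e.2 ∧ σ ∈ L.Div ∧
      ∃ t, a = some t ∧ B.Reach B.init (κ.take e.1) t

variable {L κ x} {B : LTS.{u, v} Act} {c : Act}

theorem divInvariant_step {σ : List Act} {p p' : (L.shadowed (divDriver L κ x) c B).State}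
    {l : Option Act} (hp : divInvariant L κ x B σ p.1 p.2)
    (h : (L.shadowed (divDriver L κ x) c B).trans p l p') :
    divInvariant L κ x B (σ ++ l.toList) p'.1 p'.2 := by
  obtain ⟨a, m⟩ := p
  obtain ⟨a', m'⟩ := p'
  rcases h with ⟨rfl, h, h'⟩ | ⟨h, h'⟩ | ⟨b, h, h'⟩
  · simp only [Option.toList_none, List.append_nil]
    cases h'
    cases m with
    | wait T s =>
      obtain ⟨rfl, -⟩ := hp
      cases (act_trans_none.1 h).1
    | run s =>
      obtain ⟨hs, rfl | ⟨t, rfl, ht, hσ⟩⟩ := hp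
      · cases (act_trans_none.1 h).1
      · obtain ⟨t', rfl, hb⟩ := act_trans_some.1 h
        exact ⟨hs, Or.inr ⟨t', rfl, ht.tau_right hb, hσ⟩⟩
    | drive e =>
      obtain ⟨hs, hσ, t, rfl, ht⟩ := hp
      obtain ⟨t', rfl, hb⟩ := act_trans_some.1 h
      exact ⟨hs, hσ, t', rfl, ht.tau_right hb⟩
  · cases h'
    cases h with
    | wait_tau h =>
      obtain ⟨rfl, rfl, hs⟩ := hp
      exact ⟨rfl, by simp, hs.step h⟩
    | wait_vis h =>
      obtain ⟨rfl, rfl, hs⟩ := hp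
      exact ⟨rfl, after_reachSet _ _ _, hs.step h⟩
    | wait_run =>
      obtain ⟨rfl, rfl, hs⟩ := hp
      exact ⟨by simpa using hs, Or.inl rfl⟩
    | run h =>
      obtain ⟨hs, ha⟩ := hp
      refine ⟨hs.step h, ha.imp_right ?_⟩
      rintro ⟨t, ht, ht', hσ⟩
      exact ⟨t, ht, ht', extD_append hσ ⟨_, hs.step h⟩⟩
    | drive_idle => simpa using hp
    | drive h =>
      rcases h with ⟨b, -, h, -⟩ | ⟨-, h, -⟩
      · cases h
      · cases h
  · cases h' with
    | wait_drive hu hd he =>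
      obtain ⟨rfl, rfl, hs⟩ := hp
      cases he
      obtain ⟨-, ha⟩ := act_trans_none.1 h
      have hσ : σ ∈ L.Div := ⟨_, hu, hd⟩
      exact ⟨by simpa using hs, by simpa using hσ, _, ha, Reach.refl _⟩
    | drive h' =>
      obtain ⟨hs, hσ, t, rfl, ht⟩ := hp
      obtain ⟨t', ha, hb⟩ := act_trans_some.1 h
      rcases h' with ⟨d, hd, hk, rfl, rfl⟩ | ⟨he, hk, y, s', rfl, hy, rfl⟩
      · cases hk
        refine ⟨by simpa using hs, by simpa using hσ, t', ha, ?_⟩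
        have := ht.trans_right hb
        rwa [List.take_add_one, hd]
      · cases hk
        rw [he, List.take_length] at ht
        exact ⟨hs.step hy, Or.inr ⟨t', ha, ht.trans_right hb,
          extD_append (Div_subset_extD hσ) ⟨_, hs.step hy⟩⟩⟩

theorem divInvariant_reach {σ : List Act} {p : (L.shadowed (divDriver L κ x) c B).State}
    (h : (L.shadowed (divDriver L κ x) c B).Reach
      (L.shadowed (divDriver L κ x) c B).init σ p) :
    divInvariant L κ x B σ p.1 p.2 :=
  Reach.invariant (fun σ (p : (L.shadowed (divDriver L κ x) c B).State) =>
    divInvariant L κ x B σ p.1 p.2) ⟨rfl, rfl, Reach.refl _⟩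
    (fun _ _ _ _ hp h => divInvariant_step hp h) h

theorem Sf_shadowed_div : (L.shadowed (divDriver L κ x) c B).Sf = L.Sf :=
  Sf_shadowed fun _ _ _ h => (divInvariant_reach h).1

/-- The state of `L` followed by a state of the controller. -/
def divProj : ShadowState L.State (ℕ × L.State) → L.State
  | .wait _ s => s
  | .run s => s
  | .drive e => e.2

theorem divProj_step {p p' : (L.shadowed (divDriver L κ x) c B).State} {l : Option Act}
    (h : (L.shadowed (divDriver L κ x) c B).trans p l p') :
    L.trans (divProj p.2) l (divProj p'.2) ∨ l = none ∧ divProj p'.2 = divProj p.2 := by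
  obtain ⟨a, m⟩ := p
  obtain ⟨a', m'⟩ := p'
  rcases h with ⟨rfl, -, h'⟩ | ⟨h, -⟩ | ⟨b, -, h⟩
  · exact Or.inr ⟨rfl, congrArg divProj h'⟩
  · cases h with
    | wait_tau h => exact Or.inl h
    | wait_vis h => exact Or.inl h
    | wait_run => exact Or.inr ⟨rfl, rfl⟩
    | run h => exact Or.inl h
    | drive_idle => exact Or.inr ⟨rfl, rfl⟩
    | drive h =>
      rcases h with ⟨b, -, h, -⟩ | ⟨-, h, -⟩
      · cases h
      · cases h
  · cases h with
    | wait_drive _ _ h =>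
      cases h
      exact Or.inr ⟨rfl, rfl⟩
    | drive h =>
      rcases h with ⟨b, -, -, rfl, rfl⟩ | ⟨-, -, y, s', rfl, h, rfl⟩
      · exact Or.inr ⟨rfl, rfl⟩
      · exact Or.inl h

/-- Every product state carries a state of `L`, which τ-moves of `B` and the silent performance of
`κ` leave fixed. The action shown together with `x` is a genuine transition of `L`, so the
projection is a weak simulation. -/
theorem Inf_shadowed_div : (L.shadowed (divDriver L κ x) c B).Inf = L.Inf := by
  refine Set.Subset.antisymm (fun ξ hξ => ?_) Inf_subset_shadowed
  refine InfReach.map (fun p : (L.shadowed (divDriver L κ x) c B).State => divProj p.2)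
    ?_ ?_ hξ
  · intro p p' h
    rcases divProj_step h with h | ⟨-, h⟩
    · exact Relation.ReflTransGen.single h
    · exact h ▸ Relation.ReflTransGen.refl
  · intro p a p' h
    rcases divProj_step h with h | ⟨h, -⟩
    · exact Reach.of_trans h
    · cases h

theorem Div_shadowed_div_subset : (L.shadowed (divDriver L κ x) c B).Div ⊆ L.extD := by
  rintro σ ⟨⟨a, m⟩, h, hdiv⟩
  by_contra hσ
  have hσ' : σ ∉ L.Div := fun h => hσ (Div_subset_extD h)
  have hinv := divInvariant_reach h
  refine not_diverges_iff.2 ?_ hdiv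
  cases m with
  | wait T s =>
    obtain ⟨rfl, rfl, hs⟩ := hinv
    exact shadowed_converges_wait (fun u hu hu' => hσ' ⟨u, hu, hu'⟩)
      (converges_of_not_mem_Div hs hσ')
  | run s =>
    obtain ⟨hs, rfl | ⟨t, -, -, h⟩⟩ := hinv
    · exact shadowed_converges_run converges_act_none (converges_of_not_mem_Div hs hσ')
    · exact absurd h hσ
  | drive e => exact absurd hinv.2.1 hσ'

/-- Driving states occur only after divergence traces of `L`, where their idling does no harm. A
running state reached by driving holds `B` after `κ ++ [x]`, where it converges. -/
theorem Div_shadowed_div_of_not_mem (hB : κ ++ [x] ∉ B.Div) :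
    (L.shadowed (divDriver L κ x) c B).Div = L.Div := by
  refine Set.Subset.antisymm ?_ Div_subset_shadowed
  rintro σ ⟨⟨a, m⟩, h, hdiv⟩
  by_contra hσ
  have hinv := divInvariant_reach h
  refine not_diverges_iff.2 ?_ hdiv
  cases m with
  | wait T s =>
    obtain ⟨rfl, rfl, hs⟩ := hinv
    exact shadowed_converges_wait (fun u hu hu' => hσ ⟨u, hu, hu'⟩)
      (converges_of_not_mem_Div hs hσ)
  | run s =>
    obtain ⟨hs, rfl | ⟨t, rfl, ht, -⟩⟩ := hinv
    · exact shadowed_converges_run converges_act_none (converges_of_not_mem_Div hs hσ)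
    · exact shadowed_converges_run (converges_act_some (converges_of_not_mem_Div ht hB))
        (converges_of_not_mem_Div hs hσ)
  | drive e => exact absurd hinv.2.1 hσ

theorem shadowed_tau_act {a a' : Option B.State} {D : Driver L}
    {m : ShadowState L.State D.State} (h : (B.act c).TauReach a a') :
    (L.shadowed D c B).TauReach (pair L D c B a m) (pair L D c B a' m) := by
  induction h with
  | refl => exact Relation.ReflTransGen.refl
  | tail _ h ih => exact ih.tail (Or.inl ⟨rfl, h, rfl⟩)

theorem tauReach_act_some {t t' : B.State} (h : B.TauReach t t') :
    (B.act c).TauReach (some t) (some t') := by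
  induction h with
  | refl => exact Relation.ReflTransGen.refl
  | tail _ h ih => exact ih.tail (act_trans_some.2 ⟨_, rfl, h⟩)

theorem shadowed_drive {D : Driver L} {t t' t'' : B.State} {e : D.State} {k : Act}
    {l : Option Act} {m : ShadowState L.State D.State} (h : B.TauReach t t')
    (h' : B.trans t' (some k) t'') (hD : D.trans e (some k) l m) :
    (L.shadowed D c B).Reach (pair L D c B (some t) (.drive e)) l.toList
      (pair L D c B (some t'') m) := by
  have h1 : (L.shadowed D c B).TauReach (pair L D c B (some t) (.drive e))
      (pair L D c B (some t') (.drive e)) := shadowed_tau_act (tauReach_act_some h)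
  have h2 : (L.shadowed D c B).trans (pair L D c B (some t') (.drive e)) l
      (pair L D c B (some t'') m) :=
    Or.inr (Or.inr ⟨k, act_trans_some.2 ⟨_, rfl, h'⟩, .drive hD⟩)
  exact Reach.tau_left h1 (Reach.step (Reach.refl _) h2)

theorem shadowed_drive_divDriver {s : L.State} {ρ ρ' : List Act} {t t' : B.State}
    (h : B.Reach t ρ' t') :
    ρ ++ ρ' = κ → (L.shadowed (divDriver L κ x) c B).Reach
      (pair L _ c B (some t) (.drive (ρ.length, s))) []
      (pair L _ c B (some t') (.drive (κ.length, s))) := by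
  induction ρ' generalizing ρ t with
  | nil =>
    intro hκ
    rw [← hκ, List.append_nil]
    exact shadowed_tau_act (tauReach_act_some h)
  | cons a ρ' ih =>
    intro hκ
    obtain ⟨y, z, h1, h2, h3⟩ := h
    have h4 := ih (ρ := ρ ++ [a]) h3 (by simp [hκ])
    have h5 := shadowed_drive (D := divDriver L κ x) (c := c) (e := (ρ.length, s)) h1 h2
      (l := none) (m := .drive (ρ.length + 1, s)) (Or.inl ⟨a, by simp [← hκ], rfl, rfl, rfl⟩)
    simp only [List.length_append, List.length_cons, List.length_nil, Nat.zero_add] at h4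
    exact h5.append h4

/-- After a divergent prefix `π`, `B` performs `κ` silently and then `x` under the next visible
action `y`. The copy of `L` completes the trace, and `B` supplies the divergence at its end. -/
theorem Div_shadowed_div_of_mem (hB : κ ++ [x] ∈ B.Div) :
    (L.shadowed (divDriver L κ x) c B).Div = L.extD := by
  refine Set.Subset.antisymm Div_shadowed_div_subset ?_
  rintro σ ⟨⟨s₂, hs₂⟩, π, ⟨u, hu, hdu⟩, ρ, rfl⟩
  obtain ⟨s, hs, hρ⟩ := reach_append.1 hs₂
  cases ρ with
  | nil =>
    rw [List.append_nil]
    exact Div_subset_shadowed ⟨u, hu, hdu⟩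
  | cons y ρ =>
    obtain ⟨s', s₁, h1, h2, h3⟩ := hρ
    obtain ⟨t₂, ht₂, hdiv⟩ := hB
    obtain ⟨t₁, ht₁, ht₂⟩ := reach_append.1 ht₂
    obtain ⟨w, w', hw, hw', hw''⟩ := ht₂
    obtain ⟨q, hq0, hq⟩ := hdiv
    have h7 : (L.shadowed (divDriver L κ x) c B).Reach (L.shadowed (divDriver L κ x) c B).init π
        (pair L _ c B none (.wait (L.reachSet π) s')) := by
      exact shadowed_reach_wait (hs.tauReach_right h1)
    -- The divergent state `u` only licenses driving; the driver continues from `s'`, which can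
    -- perform `y`.
    have h5 : (L.shadowed (divDriver L κ x) c B).trans
        (pair L _ c B none (.wait (L.reachSet π) s')) none
        (pair L _ c B (some B.init) (.drive (0, s'))) :=
      Or.inr (Or.inr ⟨c, act_trans_none.2 ⟨rfl, rfl⟩, .wait_drive hu hdu rfl⟩)
    have h8 := shadowed_drive_divDriver (L := L) (x := x) (c := c) (s := s') (ρ := []) ht₁ rfl
    have h9 := shadowed_drive (D := divDriver L κ x) (c := c) (e := (κ.length, s')) hw hw'
      (l := some y) (m := .run s₁) (Or.inr ⟨rfl, rfl, y, s₁, rfl, h2, rfl⟩)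
    have h10 := (h9.tauReach_right (shadowed_tau_act (tauReach_act_some hw''))).append
      (shadowed_reach_run h3)
    refine ⟨_, h7.append ((Reach.of_tau h5).append (h8.append h10)), ?_⟩
    exact ⟨fun i => pair L _ c B (some (q i)) (.run s₂),
      congrArg (fun t => pair L (divDriver L κ x) c B (some t) (.run s₂)) hq0,
      fun i => Or.inl ⟨rfl, act_trans_some.2 ⟨_, rfl, hq i⟩, rfl⟩⟩

end AddDiv

/-! ### Adding infinite traces -/

section AddInf

variable (L : LTS.{u, v} Act) (ξ : ℕ → Act)

/-- The driver that performs `ξ`, showing any trace of `L`. -/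
def infDriver : Driver L where
  State := ℕ × Set L.State
  start T _ e := e = (0, T)
  trans e k l m := ∃ y, (L.after e.2 y).Nonempty ∧ k = some (ξ e.1) ∧ l = some y ∧
    m = .drive (e.1 + 1, L.after e.2 y)
  trans_mem := by
    rintro e k b m ⟨y, ⟨t, s, -, h⟩, -, hy, -⟩
    cases hy
    exact h.mem_alphabet _ (by simp)

/-- Invariant of the product with the driver `infDriver`. -/
def infInvariant (B : LTS.{u, v} Act) (σ : List Act) (a : Option B.State) :
    ShadowState L.State (ℕ × Set L.State) → Prop
  | .wait T s => a = none ∧ T = L.reachSet σ ∧ L.Reach L.init σ s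
  | .run s => a = none ∧ L.Reach L.init σ s
  | .drive e => e.2 = L.reachSet σ ∧ σ ∈ L.extD ∧
      ∃ t, a = some t ∧ B.Reach B.init ((List.range e.1).map ξ) t

variable {L ξ} {B : LTS.{u, v} Act} {c : Act}

theorem infInvariant_step {σ : List Act} {p p' : (L.shadowed (infDriver L ξ) c B).State}
    {l : Option Act} (hp : infInvariant L ξ B σ p.1 p.2)
    (h : (L.shadowed (infDriver L ξ) c B).trans p l p') :
    infInvariant L ξ B (σ ++ l.toList) p'.1 p'.2 := by
  obtain ⟨a, m⟩ := p
  obtain ⟨a', m'⟩ := p'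
  rcases h with ⟨rfl, h, h'⟩ | ⟨h, h'⟩ | ⟨b, h, h'⟩
  · simp only [Option.toList_none, List.append_nil]
    cases h'
    cases m with
    | wait T s =>
      obtain ⟨rfl, -⟩ := hp
      cases (act_trans_none.1 h).1
    | run s =>
      obtain ⟨rfl, -⟩ := hp
      cases (act_trans_none.1 h).1
    | drive e =>
      obtain ⟨he, hσ, t, rfl, ht⟩ := hp
      obtain ⟨t', rfl, hb⟩ := act_trans_some.1 h
      exact ⟨he, hσ, t', rfl, ht.tau_right hb⟩
  · cases h'
    cases h with
    | wait_tau h =>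
      obtain ⟨rfl, rfl, hs⟩ := hp
      exact ⟨rfl, by simp, hs.step h⟩
    | wait_vis h =>
      obtain ⟨rfl, rfl, hs⟩ := hp
      exact ⟨rfl, after_reachSet _ _ _, hs.step h⟩
    | wait_run =>
      obtain ⟨rfl, rfl, hs⟩ := hp
      exact ⟨rfl, by simpa using hs⟩
    | run h => exact ⟨hp.1, hp.2.step h⟩
    | drive_idle => simpa using hp
    | drive h =>
      obtain ⟨y, -, h, -⟩ := h
      cases h
  · cases h' with
    | wait_drive hu hd he =>
      obtain ⟨rfl, rfl, hs⟩ := hp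
      cases he
      obtain ⟨-, ha⟩ := act_trans_none.1 h
      have hσ : σ ∈ L.extD := Div_subset_extD ⟨_, hu, hd⟩
      exact ⟨by simp, by simpa using hσ, _, ha, Reach.refl _⟩
    | drive h' =>
      obtain ⟨he, hσ, t, rfl, ht⟩ := hp
      obtain ⟨t', ha, hb⟩ := act_trans_some.1 h
      obtain ⟨y, hy, hk, rfl, rfl⟩ := h'
      cases hk
      have hy' := hy
      rw [he, after_reachSet] at hy'
      refine ⟨?_, extD_append hσ hy', t', ha, ?_⟩
      · change L.after _ _ = _
        rw [he, after_reachSet]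
        rfl
      · rw [map_range_succ]
        exact ht.trans_right hb

theorem infInvariant_reach {σ : List Act} {p : (L.shadowed (infDriver L ξ) c B).State}
    (h : (L.shadowed (infDriver L ξ) c B).Reach
      (L.shadowed (infDriver L ξ) c B).init σ p) :
    infInvariant L ξ B σ p.1 p.2 :=
  Reach.invariant (fun σ (p : (L.shadowed (infDriver L ξ) c B).State) =>
    infInvariant L ξ B σ p.1 p.2) ⟨rfl, rfl, Reach.refl _⟩
    (fun _ _ _ _ hp h => infInvariant_step hp h) h

theorem Sf_shadowed_inf : (L.shadowed (infDriver L ξ) c B).Sf = L.Sf :=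
  Sf_shadowed fun _ _ _ h => (infInvariant_reach h).2

/-- Driving now extends over visible actions, and idling makes all these states diverge. Their
traces are only known to be in `L.extD`, hence the hypothesis. -/
theorem Div_shadowed_inf (hL : L.extD ⊆ L.Div) :
    (L.shadowed (infDriver L ξ) c B).Div = L.Div := by
  refine Set.Subset.antisymm ?_ Div_subset_shadowed
  rintro σ ⟨⟨a, m⟩, h, hdiv⟩
  by_contra hσ
  have hinv := infInvariant_reach h
  refine not_diverges_iff.2 ?_ hdiv
  cases m with
  | wait T s =>
    obtain ⟨rfl, rfl, hs⟩ := hinv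
    exact shadowed_converges_wait (fun u hu hu' => hσ ⟨u, hu, hu'⟩)
      (converges_of_not_mem_Div hs hσ)
  | run s =>
    obtain ⟨rfl, hs⟩ := hinv
    exact shadowed_converges_run converges_act_none (converges_of_not_mem_Div hs hσ)
  | drive e => exact absurd (hL hinv.2.1) hσ

/-- The state of `L` followed by a state of the controller, as long as it does not drive. -/
def infProj : ShadowState L.State (ℕ × Set L.State) → L.State
  | .wait _ s => s
  | .run s => s
  | .drive _ => L.init

/-- The controller is driving. -/
def IsDriving : ShadowState L.State (ℕ × Set L.State) → Prop
  | .drive _ => True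
  | _ => False

/-- Driving is never left, so the non-driving states are closed under predecessors, as `Reach.map`
requires. -/
theorem infProj_step {p p' : (L.shadowed (infDriver L ξ) c B).State} {l : Option Act}
    (h : (L.shadowed (infDriver L ξ) c B).trans p l p') (hp' : ¬ IsDriving p'.2) :
    ¬ IsDriving p.2 ∧ (L.trans (infProj p.2) l (infProj p'.2) ∨
      l = none ∧ infProj p'.2 = infProj p.2) := by
  obtain ⟨a, m⟩ := p
  obtain ⟨a', m'⟩ := p'
  rcases h with ⟨rfl, -, h'⟩ | ⟨h, -⟩ | ⟨b, -, h⟩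
  · have h' : m' = m := h'
    subst h'
    exact ⟨hp', Or.inr ⟨rfl, rfl⟩⟩
  · cases h with
    | wait_tau h => exact ⟨id, Or.inl h⟩
    | wait_vis h => exact ⟨id, Or.inl h⟩
    | wait_run => exact ⟨id, Or.inr ⟨rfl, rfl⟩⟩
    | run h => exact ⟨id, Or.inl h⟩
    | drive_idle => exact absurd trivial hp'
    | drive h =>
      obtain ⟨y, -, h, -⟩ := h
      cases h
  · cases h with
    | wait_drive _ _ h => exact absurd trivial hp'
    | drive h =>
      obtain ⟨y, -, -, -, rfl⟩ := h
      exact absurd trivial hp'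

theorem shadowed_tauReach_drive {t : B.State} {e : ℕ × Set L.State}
    {p : (L.shadowed (infDriver L ξ) c B).State}
    (h : (L.shadowed (infDriver L ξ) c B).TauReach (pair L _ c B (some t) (.drive e)) p) :
    ∃ t', p = pair L _ c B (some t') (.drive e) ∧ B.TauReach t t' := by
  induction h with
  | refl => exact ⟨t, rfl, Relation.ReflTransGen.refl⟩
  | @tail p p' _ h ih =>
    obtain ⟨t', rfl, ht⟩ := ih
    obtain ⟨a, m⟩ := p'
    rcases h with ⟨-, h, rfl⟩ | ⟨h, rfl⟩ | ⟨b, -, h⟩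
    · obtain ⟨t'', rfl, hb⟩ := act_trans_some.1 h
      exact ⟨t'', rfl, ht.tail hb⟩
    · cases h with
      | drive_idle => exact ⟨t', rfl, ht⟩
      | drive h =>
        obtain ⟨y, -, h, -⟩ := h
        cases h
    · cases h with
      | drive h =>
        obtain ⟨y, -, -, h, -⟩ := h
        cases h

theorem shadowed_reach_drive {t : B.State} {e : ℕ × Set L.State} {y : Act}
    {p : (L.shadowed (infDriver L ξ) c B).State}
    (h : (L.shadowed (infDriver L ξ) c B).Reach (pair L _ c B (some t) (.drive e)) [y] p) :
    ∃ t' T, p = pair L _ c B (some t') (.drive (e.1 + 1, T)) ∧ B.Reach t [ξ e.1] t' := by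
  obtain ⟨q, q', h1, h2, h3⟩ := h
  obtain ⟨t₁, rfl, ht₁⟩ := shadowed_tauReach_drive h1
  obtain ⟨a, m⟩ := q'
  rcases h2 with ⟨h, -⟩ | ⟨h, -⟩ | ⟨b, h, h'⟩
  · cases h
  · cases h with
    | drive h =>
      obtain ⟨y, -, h, -⟩ := h
      cases h
  · obtain ⟨t₂, rfl, hb⟩ := act_trans_some.1 h
    cases h' with
    | drive h' =>
      obtain ⟨y, -, hk, -, rfl⟩ := h'
      cases hk
      obtain ⟨t₃, rfl, ht₃⟩ := shadowed_tauReach_drive h3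
      exact ⟨t₃, _, rfl, t₁, t₂, ht₁, hb, ht₃⟩

/-- The infinite sequences whose prefixes are traces, one of them a divergence trace. -/
def extInf (L : LTS.{u, v} Act) : Set (ℕ → Act) :=
  {η | (∀ n, (List.range n).map η ∈ L.Tr) ∧ ∃ n, (List.range n).map η ∈ L.Div}

theorem prefix_map_range {η : ℕ → Act} {π : List Act} {n : ℕ}
    (h : π <+: (List.range n).map η) : π = (List.range π.length).map η := by
  have h1 := h.length_le
  rw [List.prefix_iff_eq_take, ← List.map_take, List.take_range] at h
  simp only [List.length_map, List.length_range] at h1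
  rwa [min_eq_left h1] at h

/-- A path that never drives projects to `L`. Once driving has begun, each visible action consumes
the next action of `ξ` in `B`, so an infinite path makes `B` perform all of `ξ`. -/
theorem exists_reach_of_mem_Inf_shadowed {η : ℕ → Act}
    (hη : η ∈ (L.shadowed (infDriver L ξ) c B).Inf) :
    η ∈ L.Inf ∨ ξ ∈ B.Inf ∧ ∃ n, (List.range n).map η ∈ L.extD := by
  obtain ⟨p, h0, hp⟩ := infReach_iff.1 hη
  have hreach := fun n => h0 ▸ reach_map_range hp n
  by_cases hdr : ∃ n, IsDriving (p n).2
  · right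
    obtain ⟨n, hn⟩ := hdr
    have hinv := infInvariant_reach (hreach n)
    obtain ⟨a, m, hpn⟩ : ∃ a m, p n = pair L _ c B a m := ⟨_, _, rfl⟩
    rw [hpn] at hn hinv
    cases m with
    | wait T s => exact hn.elim
    | run s => exact hn.elim
    | drive e =>
      obtain ⟨he, hσ, t, rfl, ht⟩ := hinv
      refine ⟨InfReach.append ht (infReach_of_forall_exists
        (fun k t => ∃ T, p (n + k) = pair L _ c B (some t) (.drive (e.1 + k, T))) ?_
        ⟨e.2, hpn⟩), n, hσ⟩
      rintro k t ⟨T, hk⟩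
      have h1 := hp (n + k)
      rw [hk] at h1
      obtain ⟨t', T', h2, h3⟩ := shadowed_reach_drive h1
      exact ⟨t', h3, T', h2⟩
  · left
    push Not at hdr
    refine infReach_iff.2 ⟨fun n => infProj (p n).2,
      congrArg (fun x : (L.shadowed (infDriver L ξ) c B).State => infProj x.2) h0, fun i => ?_⟩
    refine (Reach.map (fun p : (L.shadowed (infDriver L ξ) c B).State => infProj p.2)
      (fun p => ¬ IsDriving p.2) (fun x l y h hy => (infProj_step h hy).1) ?_ ?_ (hp i)
      (hdr (i + 1))).1
    · intro x y h hy
      rcases (infProj_step h hy).2 with h | ⟨-, h⟩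
      · exact Relation.ReflTransGen.single h
      · exact h ▸ Relation.ReflTransGen.refl
    · intro x a y h hy
      rcases (infProj_step h hy).2 with h | ⟨h, -⟩
      · exact Reach.of_trans h
      · cases h

theorem Inf_shadowed_inf_of_not_mem (hB : ξ ∉ B.Inf) :
    (L.shadowed (infDriver L ξ) c B).Inf = L.Inf :=
  Set.Subset.antisymm (fun _ h =>
    (exists_reach_of_mem_Inf_shadowed h).resolve_right fun h => hB h.1) Inf_subset_shadowed

/-- The driver may show any action under which the set of reached states stays nonempty. While `B`
performs `ξ`, it can thus show any sequence whose prefixes are traces, whether or not `L` has it as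
an infinite trace. -/
theorem Inf_shadowed_inf_of_mem (hB : ξ ∈ B.Inf)
    (hTr : (L.shadowed (infDriver L ξ) c B).Tr ⊆ L.Tr) :
    (L.shadowed (infDriver L ξ) c B).Inf = L.Inf ∪ L.extInf := by
  refine Set.Subset.antisymm (fun η h => ?_) (Set.union_subset Inf_subset_shadowed ?_)
  · refine (exists_reach_of_mem_Inf_shadowed h).imp_right ?_
    rintro ⟨-, n, -, π, hπ, hn⟩
    exact ⟨fun n => hTr (Inf.mem_Tr h n), π.length, prefix_map_range hn ▸ hπ⟩
  · rintro η ⟨hη, n, u, hu, hdu⟩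
    obtain ⟨p, q, h0, hpq⟩ := hB
    have h1 := shadowed_reach_wait (B := B) (D := infDriver L ξ) (c := c) hu
    have h2 : (L.shadowed (infDriver L ξ) c B).trans
        (pair L _ c B none (.wait (L.reachSet ((List.range n).map η)) u)) none
        (pair L _ c B (some B.init) (.drive (0, L.reachSet ((List.range n).map η)))) :=
      Or.inr (Or.inr ⟨c, act_trans_none.2 ⟨rfl, rfl⟩, .wait_drive hu hdu rfl⟩)
    refine InfReach.append (h1.tau_right h2) (infReach_of_forall_exists
      (fun k x => x = pair L _ c B (some (p k))
        (.drive (k, L.reachSet ((List.range (n + k)).map η)))) ?_ (by simp [h0]))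
    rintro k _ rfl
    refine ⟨_, shadowed_drive (D := infDriver L ξ) (l := some (η (n + k))) (hpq k).1 (hpq k).2
      ⟨η (n + k), ?_, rfl, rfl, rfl⟩, ?_⟩
    · change (L.after (L.reachSet _) _).Nonempty
      rw [after_reachSet, ← map_range_succ]
      exact hη (n + k + 1)
    · change pair L (infDriver L ξ) c B _ (.drive (k + 1, L.after (L.reachSet _) _)) = _
      rw [after_reachSet, ← map_range_succ]
      rfl

end AddInf

/-! ### Saturation -/

section Saturation

variable {r : LTS.{u, v} Act → LTS.{u, v} Act → Prop}

theorem IsCongruence.exists_of_not_preserves (hr : IsCongruence r) {β : Type*}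
    {X : LTS.{u, v} Act → Set β} (h : ¬ Preserves r X) :
    ∃ B B' x, r B B' ∧ x ∈ X B ∧ x ∉ X B' := by
  by_contra hcon
  push Not at hcon
  exact h fun L L' hL => Set.Subset.antisymm (fun x hx => hcon L L' x hL hx)
    fun x hx => hcon L' L x (hr.equivalence.symm hL) hx

theorem IsCongruence.shadowed [Infinite Act] (hr : IsCongruence r) (hTr : Preserves r Tr)
    {B B' : LTS.{u, v} Act} (h : r B B') (L : LTS.{u, v} Act) (D : Driver L) (c : Act)
    (hD : ∀ e a l m, D.trans e (some a) l m → a ∈ B.alphabet) :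
    r (L.shadowed D c B) (L.shadowed D c B') := by
  have hact := hr.act c h
  refine hr.control hact (hr.alphabet_eq hTr hact) _ ?_
  rintro n a l n' h
  cases h with
  | wait_drive _ _ _ => exact Or.inr rfl
  | drive h => exact Or.inl (hD _ _ _ _ h)

theorem IsCongruence.exists_Div_eq_extD [Infinite Act] (hr : IsCongruence r)
    (hCFFD : ∀ L L' : LTS.{u, v} Act, CFFD L L' → r L L') (hTr : Preserves r Tr)
    (hminD : Preserves r minD) (hDiv : ¬ Preserves r Div) (L : LTS.{u, v} Act) :
    ∃ M, r L M ∧ M.alphabet = L.alphabet ∧ M.Sf = L.Sf ∧ M.Div = L.extD ∧ M.Inf = L.Inf := by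
  obtain ⟨B, B', σ, hB, hσ, hσ'⟩ := hr.exists_of_not_preserves hDiv
  obtain ⟨c⟩ : Nonempty Act := inferInstance
  rcases List.eq_nil_or_concat' σ with rfl | ⟨κ, x, rfl⟩
  -- Preservation of `minD` excludes the empty trace, so there is a last action `x` to pair with a
  -- visible one.
  · have : [] ∈ B.minD := ⟨hσ, by simp⟩
    rw [hminD hB] at this
    exact absurd this.1 hσ'
  · refine ⟨L.shadowed (divDriver L κ x) c B, ?_, rfl, Sf_shadowed_div,
      Div_shadowed_div_of_mem hσ, Inf_shadowed_div⟩
    refine hr.equivalence.trans (hCFFD _ (L.shadowed (divDriver L κ x) c B') ⟨rfl,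
      Sf_shadowed_div.symm, (Div_shadowed_div_of_not_mem hσ').symm, Inf_shadowed_div.symm⟩)
      (hr.equivalence.symm (hr.shadowed hTr hB L _ c ?_))
    obtain ⟨s, hs, -⟩ := hσ
    rintro e a l m (⟨b, hb, hk, -⟩ | ⟨-, hk, -⟩)
    · cases hk
      exact hs.mem_alphabet a (List.mem_append_left _ (List.mem_of_getElem? hb))
    · cases hk
      exact hs.mem_alphabet _ (by simp)

theorem IsCongruence.exists_Inf_eq_union_extInf [Infinite Act] (hr : IsCongruence r)
    (hCFFD : ∀ L L' : LTS.{u, v} Act, CFFD L L' → r L L') (hTr : Preserves r Tr)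
    (hInf : ¬ Preserves r Inf) {L : LTS.{u, v} Act} (hL : L.extD ⊆ L.Div) :
    ∃ M, r L M ∧ M.alphabet = L.alphabet ∧ M.Sf = L.Sf ∧ M.Div = L.Div ∧
      M.Inf = L.Inf ∪ L.extInf := by
  obtain ⟨B, B', ξ, hB, hξ, hξ'⟩ := hr.exists_of_not_preserves hInf
  obtain ⟨c⟩ : Nonempty Act := inferInstance
  -- This relation is established first, so that preservation of `Tr` bounds the traces of the new
  -- LTS.
  have h : r L (L.shadowed (infDriver L ξ) c B) := by
    refine hr.equivalence.trans (hCFFD _ (L.shadowed (infDriver L ξ) c B') ⟨rfl,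
      Sf_shadowed_inf.symm, (Div_shadowed_inf hL).symm, (Inf_shadowed_inf_of_not_mem hξ').symm⟩)
      (hr.equivalence.symm (hr.shadowed hTr hB L _ c ?_))
    rintro e a l m ⟨y, -, hk, -⟩
    cases hk
    obtain ⟨s, hs⟩ := Inf.mem_Tr hξ (e.1 + 1)
    exact hs.mem_alphabet _ (by simp [List.range_succ])
  exact ⟨_, h, rfl, Sf_shadowed_inf, Div_shadowed_inf hL,
    Inf_shadowed_inf_of_mem hξ (hTr h).superset⟩

theorem extD_eq (L : LTS.{u, v} Act) : L.extD = {σ | σ ∈ L.Tr ∧ ∃ π ∈ L.minD, π <+: σ} := by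
  ext σ
  refine and_congr_right fun _ => ⟨?_, fun ⟨π, h, h'⟩ => ⟨π, h.1, h'⟩⟩
  rintro ⟨π, h, h'⟩
  obtain ⟨n, -, hn⟩ := exists_minD_prefix h
  exact ⟨_, hn, (List.take_prefix _ _).trans h'⟩

/-- An infinite trace outside `anI` has a prefix in `minD` and is absorbed by the second set; thus
the saturated set depends only on `anI`, `Tr` and `minD`. -/
theorem Inf_union_eq (L : LTS.{u, v} Act) : L.Inf ∪ L.extInf = L.anI ∪
    {η | (∀ n, (List.range n).map η ∈ L.Tr) ∧ ∃ n, (List.range n).map η ∈ L.minD} := by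
  ext η
  constructor
  · rintro (h | ⟨h, n, hn⟩)
    · by_cases hext : η ∈ L.extI
      · exact Or.inr ⟨Inf.mem_Tr h, hext.2⟩
      · exact Or.inl ⟨h, hext⟩
    · obtain ⟨m, -, hm⟩ := exists_minD_prefix hn
      exact Or.inr ⟨h, _, prefix_map_range (List.take_prefix m _) ▸ hm⟩
  · rintro (h | ⟨h, n, hn⟩)
    · exact Or.inl h.1
    · exact Or.inr ⟨h, n, hn.1⟩

/-- Every LTS is related to one with as many divergence traces and infinite traces as its
traces and its minimal divergence traces permit. -/
theorem IsCongruence.exists_saturated [Infinite Act] (hr : IsCongruence r)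
    (hCFFD : ∀ L L' : LTS.{u, v} Act, CFFD L L' → r L L') (hTr : Preserves r Tr)
    (hminD : Preserves r minD) (hDiv : ¬ Preserves r Div) (hInf : ¬ Preserves r Inf)
    (L : LTS.{u, v} Act) :
    ∃ M, r L M ∧ M.alphabet = L.alphabet ∧ M.Sf = L.Sf ∧ M.Div = L.extD ∧
      M.Inf = L.Inf ∪ L.extInf := by
  obtain ⟨M, hM, hal, hSf, hD, hI⟩ := hr.exists_Div_eq_extD hCFFD hTr hminD hDiv L
  have hT := hTr hM
  -- Divergence is saturated first because adding infinite traces requires `M.extD ⊆ M.Div`.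
  have hext : M.extD = L.extD := by rw [extD_eq, extD_eq, hT, hminD hM]
  obtain ⟨N, hN, hal', hSf', hD', hI'⟩ :=
    hr.exists_Inf_eq_union_extInf hCFFD hTr hInf (hext.trans hD.symm).subset
  refine ⟨N, hr.equivalence.trans hM hN, hal'.trans hal, hSf'.trans hSf, hD'.trans hD, ?_⟩
  rw [hI', Inf_union_eq, Inf_union_eq, hr.anI_eq hTr hminD hM, hT, hminD hM]

end Saturation

end LTS

/-! ### The characterization of the congruence -/

theorem mainTheorem7 {Act : Type u} [Infinite Act]
    (r : LTS.{u, v} Act → LTS.{u, v} Act → Prop)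
    (hcong : LTS.IsCongruence r)
    (hCFFD : ∀ L L' : LTS.{u, v} Act, LTS.CFFD L L' → r L L')
    (hTr : LTS.Preserves r LTS.Tr)
    (hSf : LTS.Preserves r LTS.Sf)
    (hminD : LTS.Preserves r LTS.minD)
    (hDiv : ¬ LTS.Preserves r LTS.Div)
    (hInf : ¬ LTS.Preserves r LTS.Inf)
    (L L' : LTS.{u, v} Act) :
    r L L' ↔
      L.alphabet = L'.alphabet ∧ L.Tr = L'.Tr ∧ L.Sf = L'.Sf ∧
        L.minD = L'.minD ∧ L.anI = L'.anI := by
  constructor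
  · intro h
    exact ⟨hcong.alphabet_eq hTr h, hTr h, hSf h, hminD h, hcong.anI_eq hTr hminD h⟩
  · rintro ⟨h1, h2, h3, h4, h5⟩
    obtain ⟨M, hM, hal, hS, hD, hI⟩ := hcong.exists_saturated hCFFD hTr hminD hDiv hInf L
    obtain ⟨M', hM', hal', hS', hD', hI'⟩ :=
      hcong.exists_saturated hCFFD hTr hminD hDiv hInf L'
    refine hcong.equivalence.trans hM (hcong.equivalence.trans (hCFFD M M' ⟨?_, ?_, ?_, ?_⟩)
      (hcong.equivalence.symm hM'))
    · rw [hal, hal', h1]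
    · rw [hS, hS', h3]
    · rw [hD, hD', LTS.extD_eq, LTS.extD_eq, h2, h4]
    · rw [hI, hI', LTS.Inf_union_eq, LTS.Inf_union_eq, h2, h4, h5]
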